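/- **Setting.** Let $I$ be a finite set of gangs. Gang $i$ has finite state and action sets $S_i,A_i$, transition probabilities $p_i(s,a,s')$, mean rewards $r_i(s,a)\ge 0$, and constraint functions $f_{i,\ell}(s,a)\in\mathbb R$, $\ell=1,\dots,L$. Let $N_i^0\ge 1$ be integers and $N=\sum_i N_i^0$. In the system with scaling parameter $h\ge 1$, gang $i$ has $hN_i^0$ processes. At each time $t=0,\dots,T$ a policy $\phi$ chooses the vector of actions as a function of $t$ and of the vector of states; given states and actions, all processes move independently according to their $p_i$. Let $Y_{i,s}(t)$ and $Z_{i,s,a}(t)$ be the numbers of processes of gang $i$ in state $s$, respectively in state $s$ under action $a$, at time $t$, divided by $hN$; let $Z(t)=(Z_{i,s,a}(t))_{i,s,a}$ and let $\|\cdot\|$ be the maximum norm. The initial state satisfies $Y(0)=y^0$ for every $h\ge1$, with $y^0$ independent of $h$. The policy $\phi$ is *feasible* if almost surely $\sum_{i,n} f_{i,\ell}(s_{i,n}(t),a_{i,n}(t))\le 0$ for all $\ell$ and all $t\le T$. Put $R^{\phi,h}=\frac1h\sum_{t\le T}\sum_{i,n} r_i(s_{i,n}(t),a_{i,n}(t))$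 and $\Gamma^{\phi,h}=\mathbb E[R^{\phi,h}]$. **Assumption.** For all $i$ and $s\in S_i$ there is an action $a_i(s)$ with $f_{i,\ell}(s,a_i(s))=\min_a f_{i,\ell}(s,a)$ for all $\ell$ simultaneously, and in every state of the scaled system the constraints hold when all processes use the actions $a_i(s)$. **Linear program.** Let $x^*\in[0,1]^{\{0,\dots,T\}\times\{(i,s,a)\}}$ be an optimal solution, with value $\Gamma^*$, of: maximise $\sum_{t}\sum_{i,s,a}r_i(s,a)\,x_t(i,s,a)\,N_i^0$ subject to $$\sum_{s',a'}x_t(i,s',a')\,p_i(s',a',s)=\sum_a x_{t+1}(i,s,a)\ (t<T),\qquad \sum_{s,a}x_t(i,s,a)=1,$$ $$\sum_a x_0(i,s,a)=\frac{N}{N_i^0}\,y^0_{i,s},\qquad \sum_{i,s,a}N_i^0x_t(i,s,a)f_{i,\ell}(s,a)\le0 .$$ Let $\overline\alpha_{i,s,a}(t)=x^*_t(i,s,a)/\sum_{a'}x^*_t(i,s,a')$ if the denominator is positive, and $1/|A_i|$ otherwise. Let $\phi(x^*)$ be the randomised policy in which at time $t$ each process of gang $i$ in state $s$ takes action $a$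 with probability $\overline\alpha_{i,s,a}(t)$, independently of the others, and let $z^{\phi(x^*)}(t)=\mathbb E[Z^{\phi(x^*),h}(t)]$. **FAB policy.** At time $t$, in a state in which $c_{i,s}$ processes of gang $i$ are in state $s$, determine numbers $K_{i,s,a}$ of processes as follows. 1. Rounding. $K_{i,s,a}=\lfloor\overline\alpha_{i,s,a}(t)\,c_{i,s}\rfloor$ for all actions except one arbitrary, fixed action $a^0_t(i,s)$, which gets the remaining $c_{i,s}-\sum_{a\ne a^0_t(i,s)}K_{i,s,a}$ processes. 2. Repair. Fix an enumeration of all triples $(i,s,a)$ in ascending order of $\overline\alpha_{i,s,a}(t)$, with arbitrary tie-breaking, and for each $\ell$ and $(i,s,a)$ a sequence of distinct actions from $a$ to $a_i(s)$ along which no $f_{i,\ell'}(s,\cdot)$, $\ell'=1,\dots,L$, increases. For $\ell=1,\dots,L$, run through the triples in the given order, skipping those with $K_{i,s,a}=0$. For a triple that is not skipped, go through the consecutive pairs $(b,b')$ of its sequence; as long as $\mathcal L_\ell=\sum_{i,s,a}K_{i,s,a}f_{i,\ell}(s,a)>0$ (with the current $K$), move $\min\{K_{i,s,b},\lceil \mathcal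 L_\ell/\Delta f\rceil\}$ processes from $b$ to $b'$ if $\Delta f=f_{i,\ell}(s,b)-f_{i,\ell}(s,b')>0$, and none if $\Delta f=0$. The FAB policy $\psi$ assigns actions to the individual processes so that exactly $K_{i,s,a}$ processes of gang $i$ in state $s$ use action $a$, in any way. The choices left free in 1 and 2 are the same for all $h$. **Proposition.** Under the assumption, the FAB policy family $\psi$ built from $x^*$ is asymptotically optimal with exponentially vanishing suboptimality. Precisely, for every $\epsilon>0$ there are $C,C_1,C_2>0$ and $H<\infty$ such that for all $h>H$ $$\mathbb P\Bigl\{\max_{t\le T}\|Z^{\psi,h}(t)-z^{\phi(x^*)}(t)\|>\epsilon\Bigr\}\le e^{-Ch},\qquad \max_{t\le T}\|\mathbb E Z^{\psi,h}(t)-z^{\phi(x^*)}(t)\|\le C_1e^{-C_2h}+\epsilon,$$ $$\mathbb P\bigl\{|R^{\psi,h}-\Gamma^*|>\epsilon\bigr\}\le e^{-Ch},\qquad |\Gamma^{\psi,h}-\Gamma^*|\le C_1e^{-C_2h}+\epsilon,$$ and $\Gamma^{\phi,h}\le\Gamma^{\psi,h}+C_1e^{-C_2h}+\epsilon$ for every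 feasible policy $\phi$. Moreover, if for all $\ell$ and $(i,s,a)$ no two actions of the sequence used for the repair of constraint $\ell$ have the same $\ell$-cost $f_{i,\ell}(s,\cdot)$, except possibly when this is the minimal cost $\min_a f_{i,\ell}(s,a)$ (for example, if the sequences are $a,a_i(s)$), then $\psi$ is feasible for every $h\ge1$. -/

import Mathlib

open scoped BigOperators

noncomputable section

/-- Weakly coupled gangs of restless multi-action bandit processes. Gang `i` has (in the unscaled
system) `N₀ i` stochastically identical processes with finite state space `S i`, finite action space
`A i`, transition probabilities `p i s a s'`, nonnegative mean rewards `r i s a`; the processes are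
coupled through the `L` linear constraints given by the functions `f i ℓ`. -/
structure WCG (ι : Type*) (S A : ι → Type*) [∀ i, Fintype (S i)] (L : ℕ) where
  N₀ : ι → ℕ
  N₀_pos : ∀ i, 0 < N₀ i
  p : ∀ i, S i → A i → S i → ℝ
  p_nonneg : ∀ i s a s', 0 ≤ p i s a s'
  p_sum : ∀ i s a, ∑ s', p i s a s' = 1
  r : ∀ i, S i → A i → ℝ
  r_nonneg : ∀ i s a, 0 ≤ r i s a
  f : ∀ i, Fin L → S i → A i → ℝ

/-- Gang-state-action triples `(i, s, a)`. -/
abbrev GSA {ι : Type*} (S A : ι → Type*) := Σ i, S i × A i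

namespace WCG

section

variable {ι : Type*} {S A : ι → Type*} {L : ℕ}
  [Fintype ι] [DecidableEq ι]
  [∀ i, Fintype (S i)] [∀ i, DecidableEq (S i)]
  [∀ i, Fintype (A i)] [∀ i, DecidableEq (A i)]

/-! ### The scaled system, policies and the law of the controlled process -/

/-- States of the system with scaling parameter `h`: gang `i` has `N_i = h * N₀ i` processes. -/
abbrev State (M : WCG ι S A L) (h : ℕ) := ∀ i, Fin (h * M.N₀ i) → S i

/-- Action vectors of the system with scaling parameter `h`. -/
abbrev Action (M : WCG ι S A L) (h : ℕ) := ∀ i, Fin (h * M.N₀ i) → A i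

/-- A (deterministic Markov) policy on the horizon `0, …, T`. -/
abbrev Policy (M : WCG ι S A L) (T h : ℕ) := Fin (T + 1) → M.State h → M.Action h

/-- Conditional probabilities `π t s a` of the action vector `a` given the state `s` at time `t`. -/
abbrev ActionLaw (M : WCG ι S A L) (T h : ℕ) := Fin (T + 1) → M.State h → M.Action h → ℝ

/-- A deterministic policy seen as a (degenerate) action law. -/
def Policy.law {M : WCG ι S A L} {T h : ℕ} (φ : M.Policy T h) : M.ActionLaw T h :=
  fun t s a => if a = φ t s then 1 else 0

/-- State-action trajectories on the horizon `0, …, T`. -/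
abbrev Traj (M : WCG ι S A L) (T h : ℕ) := Fin (T + 1) → M.State h × M.Action h

/-- Given states and actions, all the processes move independently with their own transition
probabilities. -/
def trans (M : WCG ι S A L) {h : ℕ} (s : M.State h) (a : M.Action h) (s' : M.State h) : ℝ :=
  ∏ i, ∏ n, M.p i (s i n) (a i n) (s' i n)

/-- The probability of the trajectory `ω`, started at `s₀` and controlled by `π`. -/
def trajProb (M : WCG ι S A L) {T h : ℕ} (s₀ : M.State h) (π : M.ActionLaw T h)
    (ω : M.Traj T h) : ℝ :=
  if (ω 0).1 = s₀ then
    (∏ t : Fin (T + 1), π t (ω t).1 (ω t).2) *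
      ∏ t : Fin T, M.trans (ω t.castSucc).1 (ω t.castSucc).2 (ω t.succ).1
  else 0

/-- Expectation with respect to the law of the controlled process. -/
def expect (M : WCG ι S A L) {T h : ℕ} (s₀ : M.State h) (π : M.ActionLaw T h)
    (X : M.Traj T h → ℝ) : ℝ :=
  ∑ ω, M.trajProb s₀ π ω * X ω

/-- Probability of an event with respect to the law of the controlled process. -/
def prob (M : WCG ι S A L) {T h : ℕ} (s₀ : M.State h) (π : M.ActionLaw T h)
    (E : Set (M.Traj T h)) : ℝ :=
  ∑ ω, E.indicator (M.trajProb s₀ π) ω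

/-! ### Occupation measures, rewards, constraints -/

/-- `∑ i, N_i⁰`. -/
def total (M : WCG ι S A L) : ℕ := ∑ i, M.N₀ i

/-- Number of processes of gang `i` in state `s`. -/
def stateCount (M : WCG ι S A L) {h : ℕ} (σ : M.State h) (i : ι) (s : S i) : ℕ :=
  (Finset.univ.filter fun n => σ i n = s).card

/-- Number of processes of gang `i` in state `s` under action `a`. -/
def gsaCount (M : WCG ι S A L) {h : ℕ} (σ : M.State h) (α : M.Action h) (j : GSA S A) : ℕ :=
  (Finset.univ.filter fun n => σ j.1 n = j.2.1 ∧ α j.1 n = j.2.2).card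

/-- `Y_{i,s}`: the fraction (among all processes) of processes of gang `i` in state `s`. -/
def Y (M : WCG ι S A L) {h : ℕ} (σ : M.State h) (i : ι) (s : S i) : ℝ :=
  (M.stateCount σ i s : ℝ) / ((h : ℝ) * M.total)

/-- `Z_{i,s,a}`: the fraction (among all processes) of processes in the triple `(i, s, a)`. -/
def Z (M : WCG ι S A L) {h : ℕ} (q : M.State h × M.Action h) : GSA S A → ℝ :=
  fun j => (M.gsaCount q.1 q.2 j : ℝ) / ((h : ℝ) * M.total)

/-- `z(t) = E[Z(t)]`. -/
def meanZ (M : WCG ι S A L) {T h : ℕ} (s₀ : M.State h) (π : M.ActionLaw T h) (t : Fin (T + 1)) :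
    GSA S A → ℝ :=
  fun j => M.expect s₀ π fun ω => M.Z (ω t) j

/-- The cumulative (mean) reward along a trajectory, divided by `h`. -/
def pathReward (M : WCG ι S A L) {T h : ℕ} (ω : M.Traj T h) : ℝ :=
  (∑ t, ∑ i, ∑ n, M.r i ((ω t).1 i n) ((ω t).2 i n)) / h

/-- The expected cumulative reward, divided by `h`. -/
def value (M : WCG ι S A L) {T h : ℕ} (s₀ : M.State h) (π : M.ActionLaw T h) : ℝ :=
  M.expect s₀ π M.pathReward

/-- The coupling constraints for a state vector and an action vector. -/
def Constraints (M : WCG ι S A L) {h : ℕ} (σ : M.State h) (α : M.Action h) : Prop :=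
  ∀ ℓ, ∑ i, ∑ n, M.f i ℓ (σ i n) (α i n) ≤ 0

/-- The policy `φ`, started at `s₀`, almost surely satisfies the coupling constraints at all
times `0, …, T`. -/
def Feasible (M : WCG ι S A L) {T h : ℕ} (s₀ : M.State h) (φ : M.Policy T h) : Prop :=
  ∀ ω : M.Traj T h, M.trajProb s₀ φ.law ω ≠ 0 → ∀ t, M.Constraints (ω t).1 (ω t).2

/-- For each gang and state, `cheap i s` is an action that minimises all the constraint functions
simultaneously, and using these actions for all processes satisfies the constraints in every state
of the (scaled) system. -/
structure CheapestFeasible (M : WCG ι S A L) (cheap : ∀ i, S i → A i) : Prop where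
  le : ∀ i s ℓ a, M.f i ℓ s (cheap i s) ≤ M.f i ℓ s a
  constraints : ∀ h : ℕ, 0 < h → ∀ σ : M.State h, M.Constraints σ fun i n => cheap i (σ i n)

/-! ### The linear program -/

/-- Feasible points of the fluid linear program with initial fractions `y₀`; `x t (i, s, a)` stands
for the probability that a process of gang `i` is in state `s` under action `a` at time `t`. Since
`y₀` are fractions of the whole system, `y₀ i s * total / N₀ i` are the fractions in gang `i`. -/
structure LPFeasible (M : WCG ι S A L) {T : ℕ} (y₀ : ∀ i, S i → ℝ)
    (x : Fin (T + 1) → GSA S A → ℝ) : Prop where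
  mem_Icc : ∀ t j, x t j ∈ Set.Icc (0 : ℝ) 1
  flow : ∀ (t : Fin T) (i : ι) (s : S i),
    ∑ s', ∑ a', x t.castSucc ⟨i, s', a'⟩ * M.p i s' a' s = ∑ a, x t.succ ⟨i, s, a⟩
  sum_one : ∀ t i, ∑ s, ∑ a, x t ⟨i, s, a⟩ = 1
  init : ∀ i s, ∑ a, x 0 ⟨i, s, a⟩ = (M.total : ℝ) / M.N₀ i * y₀ i s
  coupling : ∀ ℓ t, ∑ j : GSA S A, (M.N₀ j.1 : ℝ) * x t j * M.f j.1 ℓ j.2.1 j.2.2 ≤ 0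

/-- The objective of the linear program. -/
def lpValue (M : WCG ι S A L) {T : ℕ} (x : Fin (T + 1) → GSA S A → ℝ) : ℝ :=
  ∑ t, ∑ j : GSA S A, M.r j.1 j.2.1 j.2.2 * x t j * M.N₀ j.1

/-- Optimal solutions of the linear program. -/
def LPOptimal (M : WCG ι S A L) {T : ℕ} (y₀ : ∀ i, S i → ℝ)
    (x : Fin (T + 1) → GSA S A → ℝ) : Prop :=
  M.LPFeasible y₀ x ∧ ∀ x' : Fin (T + 1) → GSA S A → ℝ, M.LPFeasible y₀ x' →
    M.lpValue x' ≤ M.lpValue x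

/-- The action probabilities extracted from an LP solution. -/
def alphaLP {T : ℕ} (x : Fin (T + 1) → GSA S A → ℝ) (t : Fin (T + 1))
    (i : ι) (s : S i) (a : A i) : ℝ :=
  if 0 < ∑ a', x t ⟨i, s, a'⟩ then x t ⟨i, s, a⟩ / ∑ a', x t ⟨i, s, a'⟩
  else 1 / (Fintype.card (A i) : ℝ)

/-- The randomised policy `φ(x)`: every process independently takes action `a` in state `s` with
probability `alphaLP x t i s a`. -/
def lpPolicy (M : WCG ι S A L) {T : ℕ} (x : Fin (T + 1) → GSA S A → ℝ) (h : ℕ) :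
    M.ActionLaw T h :=
  fun t σ α => ∏ i, ∏ n, alphaLP x t i (σ i n) (α i n)

/-! ### Fluid-approximation balancing (FAB)

The algorithm is written with numbers of processes `K (i, s, a) = h * total * Z (i, s, a)` in place
of the fractions `Z`. -/

/-- The choices that the algorithm leaves free: the action `a₀` that absorbs the rounding errors,
an enumeration of all triples in ascending order of `alphaLP` (with any tie-breaking), and, for the
repair of constraint `ℓ` and each triple `(i, s, a)`, a sequence of distinct actions from `a` down
to the cheapest action, along which no constraint function increases. -/
structure FABChoice (M : WCG ι S A L) (cheap : ∀ i, S i → A i) {T : ℕ}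
    (x : Fin (T + 1) → GSA S A → ℝ) where
  a₀ : Fin (T + 1) → ∀ i, S i → A i
  order : Fin (T + 1) → List (GSA S A)
  order_nodup : ∀ t, (order t).Nodup
  order_mem : ∀ t j, j ∈ order t
  order_sorted : ∀ t, (order t).Pairwise fun j k =>
    alphaLP x t j.1 j.2.1 j.2.2 ≤ alphaLP x t k.1 k.2.1 k.2.2
  chain : Fin L → ∀ i, S i → A i → List (A i)
  chain_head : ∀ ℓ i s a, (chain ℓ i s a).head? = some a
  chain_last : ∀ ℓ i s a, (chain ℓ i s a).getLast? = some (cheap i s)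
  chain_nodup : ∀ ℓ i s a, (chain ℓ i s a).Nodup
  chain_mono : ∀ ℓ i s a,
    (chain ℓ i s a).Pairwise fun b c => ∀ ℓ', M.f i ℓ' s c ≤ M.f i ℓ' s b

/-- Distinct actions in a sequence used for the repair of constraint `ℓ` do not have the same
`ℓ`-cost, unless this is the minimal cost. -/
def FABChoice.TieFree {M : WCG ι S A L} {cheap : ∀ i, S i → A i} {T : ℕ}
    {x : Fin (T + 1) → GSA S A → ℝ} (c : M.FABChoice cheap x) : Prop :=
  ∀ ℓ i s a, (c.chain ℓ i s a).Pairwise fun b b' =>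
    M.f i ℓ s (cheap i s) < M.f i ℓ s b → M.f i ℓ s b' < M.f i ℓ s b

/-- The rounded LP decision: `⌊alphaLP * count⌋` processes for every action other than `a₀`, all the
remaining processes get `a₀`. -/
def lpApprox (M : WCG ι S A L) {T h : ℕ} (x : Fin (T + 1) → GSA S A → ℝ)
    (a₀ : ∀ i, S i → A i) (t : Fin (T + 1)) (σ : M.State h) : GSA S A → ℕ :=
  fun j =>
    if j.2.2 = a₀ j.1 j.2.1 then
      M.stateCount σ j.1 j.2.1 -
        ∑ a ∈ Finset.univ.erase (a₀ j.1 j.2.1),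
          ⌊alphaLP x t j.1 j.2.1 a * (M.stateCount σ j.1 j.2.1 : ℝ)⌋₊
    else ⌊alphaLP x t j.1 j.2.1 j.2.2 * (M.stateCount σ j.1 j.2.1 : ℝ)⌋₊

/-- The left-hand side of constraint `ℓ` for the numbers `K` of processes. -/
def excess (M : WCG ι S A L) (ℓ : Fin L) (K : GSA S A → ℕ) : ℝ :=
  ∑ j : GSA S A, (K j : ℝ) * M.f j.1 ℓ j.2.1 j.2.2

/-- Reassign `n` processes in `(i, s)` from action `a` to action `b`. -/
def transfer (i : ι) (s : S i) (a b : A i) (n : ℕ) (K : GSA S A → ℕ) : GSA S A → ℕ :=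
  fun j => if j = ⟨i, s, a⟩ then K j - n else if j = ⟨i, s, b⟩ then K j + n else K j

/-- Number of processes whose reassignment from `a` to `b` removes the violation of constraint `ℓ`
(zero if the reassignment does not help). -/
def needed (M : WCG ι S A L) (ℓ : Fin L) (i : ι) (s : S i) (a b : A i) (K : GSA S A → ℕ) : ℕ :=
  if 0 < M.f i ℓ s a - M.f i ℓ s b then ⌈M.excess ℓ K / (M.f i ℓ s a - M.f i ℓ s b)⌉₊ else 0

/-- One reassignment from `a` to the next action `b` while constraint `ℓ` is violated. -/
def repairMove (M : WCG ι S A L) (ℓ : Fin L) (i : ι) (s : S i) (a b : A i) (K : GSA S A → ℕ) :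
    GSA S A → ℕ :=
  if 0 < M.excess ℓ K then transfer i s a b (min (K ⟨i, s, a⟩) (M.needed ℓ i s a b K)) K else K

/-- Successive reassignments along a sequence of actions. -/
def repairChain (M : WCG ι S A L) (ℓ : Fin L) (i : ι) (s : S i) :
    List (A i) → (GSA S A → ℕ) → (GSA S A → ℕ)
  | a :: b :: l, K => repairChain M ℓ i s (b :: l) (M.repairMove ℓ i s a b K)
  | _, K => K

/-- Repair of constraint `ℓ`: run through the triples in the given order, skip the empty ones, and
reassign along the sequence of actions that belongs to the triple. -/
def repair (M : WCG ι S A L) {cheap : ∀ i, S i → A i} {T : ℕ} {x : Fin (T + 1) → GSA S A → ℝ}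
    (c : M.FABChoice cheap x) (t : Fin (T + 1)) (ℓ : Fin L) (K : GSA S A → ℕ) : GSA S A → ℕ :=
  (c.order t).foldl (fun K j =>
    if K j = 0 then K else M.repairChain ℓ j.1 j.2.1 (c.chain ℓ j.1 j.2.1 j.2.2) K) K

/-- The output of the FAB algorithm at time `t` in state `σ`: the rounded LP decision, repaired for
the constraints one after the other. -/
def fabCounts (M : WCG ι S A L) {cheap : ∀ i, S i → A i} {T h : ℕ}
    {x : Fin (T + 1) → GSA S A → ℝ} (c : M.FABChoice cheap x) (t : Fin (T + 1))
    (σ : M.State h) : GSA S A → ℕ :=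
  (List.finRange L).foldl (fun K ℓ => M.repair c t ℓ K) (M.lpApprox x (c.a₀ t) t σ)

/-- `ψ` is an FAB policy: its action vectors realise the numbers output by the algorithm. -/
def IsFAB (M : WCG ι S A L) {cheap : ∀ i, S i → A i} {T h : ℕ} {x : Fin (T + 1) → GSA S A → ℝ}
    (c : M.FABChoice cheap x) (ψ : M.Policy T h) : Prop :=
  ∀ t σ j, M.gsaCount σ (ψ t σ) j = M.fabCounts c t σ j

end

end WCG

end

/-! The optimal LP point is both the mean behaviour of the randomised policy and an upper bound for
all feasible policies, and the FAB counts follow it up to deviations of order `h` with exponentially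
small probability.

Upper bound: the expected occupation numbers of a feasible policy, normalised within each gang,
satisfy the linear constraints, since the flow equations are one-step conditioning and the coupling
constraints survive taking expectations (`Feasible.lpFeasible`). Hence its value is at most that of
the program. The same recursion shows that the randomised policy has expected counts exactly `h * N₀
i * x t j` (`expect_gsaCount_lpPolicy`), so all deviations can be measured from the LP point.

Stability of the algorithm: if the state counts are within `Δ` of the fluid values, the rounded
decision is within `Δ + O(1)` of the LP point, and as that point satisfies the coupling constraints,
each violation is at most `O(Δ + 1)`. No reassignment increases any constraint function, so this
bound persists throughout the repair. Every move therefore shifts `O(Δ + 1)` processes, and the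
number of moves does not depend on `h` (`exists_fabCounts_bound`). This holds whether or not the
repair succeeds.

Concentration: given the current states and actions, the next state counts are sums of independent
bounded variables, so a Chernoff bound gives exponentially small tails around their conditional
means. Induction on time alternates this bound with the stability of the algorithm
(`expSmall_gsaCount_deviation`). Probabilities of large deviations give the statements on paths.
Adding the trivial bound on the exceptional event gives the statements on means.

Feasibility without ties: if a violation remained after the repair of a constraint, every action of
non-minimal cost would have been emptied, so the excess would equal that of the cheapest actions,
which is nonpositive (`excess_repair_nonpos`). Later repairs cannot undo this. -/

set_option linter.unusedSectionVars false

namespace WCG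

/-! ### Path sums of finite inhomogeneous Markov chains -/

section PathSums

variable {X : Type*} [Fintype X]

/-- The total weight of all paths of a stochastic chain is the total initial weight. -/
theorem sum_pathWeight {T : ℕ} (f : X → ℝ) (P : Fin T → X → X → ℝ)
    (hP : ∀ t x, ∑ y, P t x y = 1) :
    ∑ ω : Fin (T + 1) → X, f (ω 0) * ∏ t : Fin T, P t (ω t.castSucc) (ω t.succ) = ∑ x, f x := by
  induction T generalizing f with
  | zero =>
    rw [← (Equiv.funUnique (Fin 1) X).symm.sum_comp]
    simp
  | succ T ih =>
    rw [← (Fin.consEquiv fun _ => X).sum_comp, Fintype.sum_prod_type]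
    refine Finset.sum_congr rfl fun x _ => ?_
    have := ih (fun y => f x * P 0 x y) (fun t => P t.succ) (fun t => hP t.succ)
    simp only [← Finset.mul_sum, hP, mul_one] at this
    rw [← this]
    refine Finset.sum_congr rfl fun ω _ => ?_
    simp [Fin.consEquiv, Fin.prod_univ_succ, mul_assoc]

/-- One-step conditioning for path sums of a stochastic chain. -/
theorem sum_pathWeight_step {T : ℕ} (f : X → ℝ) (P : Fin T → X → X → ℝ)
    (hP : ∀ t x, ∑ y, P t x y = 1) (t : Fin T) (g : X → X → ℝ) :
    ∑ ω : Fin (T + 1) → X, (f (ω 0) * ∏ t : Fin T, P t (ω t.castSucc) (ω t.succ)) *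
        g (ω t.castSucc) (ω t.succ) =
      ∑ ω : Fin (T + 1) → X, (f (ω 0) * ∏ t : Fin T, P t (ω t.castSucc) (ω t.succ)) *
        ∑ y, P t (ω t.castSucc) y * g (ω t.castSucc) y := by
  induction T generalizing f with
  | zero => exact t.elim0
  | succ T ih =>
    induction t using Fin.cases with
    | zero =>
      have hR := sum_pathWeight (fun x => f x * ∑ y, P 0 x y * g x y) P hP
      have hR' : ∑ ω : Fin (T + 2) → X,
          (f (ω 0) * ∏ t : Fin (T + 1), P t (ω t.castSucc) (ω t.succ)) *
            ∑ y, P 0 (ω (Fin.castSucc 0)) y * g (ω (Fin.castSucc 0)) y =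
          ∑ x, f x * ∑ y, P 0 x y * g x y := by
        rw [← hR]
        refine Finset.sum_congr rfl fun ω _ => ?_
        simp only [Fin.castSucc_zero]
        ring
      rw [hR', ← (Fin.consEquiv fun _ => X).sum_comp, Fintype.sum_prod_type]
      refine Finset.sum_congr rfl fun x _ => ?_
      -- With the first point fixed, `g` depends only on the second point and is absorbed into the
      -- initial weight of the remaining path.
      have := sum_pathWeight (fun y => f x * (P 0 x y * g x y)) (fun t => P t.succ)
        (fun t => hP t.succ)
      rw [← Finset.mul_sum] at this
      rw [← this]
      refine Finset.sum_congr rfl fun ω _ => ?_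
      simp only [Fin.consEquiv, Fin.prod_univ_succ, ← Fin.succ_castSucc, Equiv.coe_fn_mk,
        Fin.castSucc_zero, Fin.cons_zero, Fin.cons_succ]
      ring
    | succ t =>
      rw [← (Fin.consEquiv fun _ => X).sum_comp, ← (Fin.consEquiv fun _ => X).sum_comp,
        Fintype.sum_prod_type_right, Fintype.sum_prod_type_right]
      -- The first point does not occur in `g`; summing it out gives a shorter chain with the law
      -- after one step as its initial weight.
      have := ih (fun y => ∑ x, f x * P 0 x y) (fun t => P t.succ) (fun t => hP t.succ) t
      convert this using 2 with ω _ ω _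
      all_goals
        simp only [Fin.consEquiv, Fin.prod_univ_succ, ← Fin.succ_castSucc, Equiv.coe_fn_mk,
          Fin.castSucc_zero, Fin.cons_zero, Fin.cons_succ, Finset.sum_mul]
        refine Finset.sum_congr rfl fun x _ => ?_
        ring

end PathSums

/-! ### Product weights and a Chernoff bound -/

section ProductWeights

variable {ι : Type*} [Fintype ι] [DecidableEq ι] {X : ι → Type*} [∀ i, Fintype (X i)]
  {m : ι → ℕ}

theorem sum_prod_prod (q : ∀ i, Fin (m i) → X i → ℝ) :
    ∑ σ : ∀ i, Fin (m i) → X i, ∏ i, ∏ n, q i n (σ i n) = ∏ i, ∏ n, ∑ s, q i n s := by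
  simp only [Finset.prod_univ_sum, Fintype.piFinset_univ]

/-- Expectation of a function of one coordinate under a product weight. -/
theorem sum_prod_prod_mul_apply (q : ∀ i, Fin (m i) → X i → ℝ) (hq : ∀ i n, ∑ s, q i n s = 1)
    (i : ι) (n : Fin (m i)) (u : ∀ i, X i → ℝ) :
    ∑ σ : ∀ i, Fin (m i) → X i, (∏ i, ∏ n, q i n (σ i n)) * u i (σ i n) =
      ∑ s, q i n s * u i s := by
  -- The function of one coordinate is written as a product over all coordinates with trivial
  -- factors elsewhere, so that the sum factorises.
  have key := sum_prod_prod fun i' n' s =>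
    q i' n' s * if (⟨i', n'⟩ : Σ i, Fin (m i)) = ⟨i, n⟩ then u i' s else 1
  have hr : ∀ i' n', ∑ s, (q i' n' s *
      if (⟨i', n'⟩ : Σ i, Fin (m i)) = ⟨i, n⟩ then u i' s else 1) =
      if (⟨i', n'⟩ : Σ i, Fin (m i)) = ⟨i, n⟩ then ∑ s, q i' n' s * u i' s else 1 := by
    intro i' n'
    split_ifs with h
    · rfl
    · simp [hq]
  simp only [hr] at key
  rw [← Fintype.prod_sigma' (fun i' n' =>
    if (⟨i', n'⟩ : Σ i, Fin (m i)) = ⟨i, n⟩ then ∑ s, q i' n' s * u i' s else 1)] at key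
  rw [Finset.prod_ite_eq' Finset.univ (⟨i, n⟩ : Σ i, Fin (m i))
    (fun k => ∑ s, q k.1 k.2 s * u k.1 s)] at key
  simp only [Finset.mem_univ, if_true] at key
  rw [← key]
  refine Finset.sum_congr rfl fun σ _ => ?_
  simp only [Finset.prod_mul_distrib]
  congr 1
  rw [← Fintype.prod_sigma' (fun i' n' =>
    if (⟨i', n'⟩ : Σ i, Fin (m i)) = ⟨i, n⟩ then u i' (σ i' n') else 1)]
  rw [Finset.prod_ite_eq' Finset.univ (⟨i, n⟩ : Σ i, Fin (m i))
    (fun k => u k.1 (σ k.1 k.2))]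
  simp

/-- Exponential tail bound for a sum of independent centred variables bounded by one. -/
theorem prod_weight_tail (q : ∀ i, Fin (m i) → X i → ℝ) (hq0 : ∀ i n s, 0 ≤ q i n s)
    (hq : ∀ i n, ∑ s, q i n s = 1) (v : ∀ i, Fin (m i) → X i → ℝ) (hv : ∀ i n s, |v i n s| ≤ 1)
    (hmean : ∀ i n, ∑ s, q i n s * v i n s = 0) {θ : ℝ} (hθ0 : 0 ≤ θ) (hθ1 : θ ≤ 1) (δ : ℝ) :
    ∑ σ : ∀ i, Fin (m i) → X i, (∏ i, ∏ n, q i n (σ i n)) *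
        (if δ < ∑ i, ∑ n, v i n (σ i n) then 1 else 0) ≤
      Real.exp (θ ^ 2 * ∑ i, (m i : ℝ) - θ * δ) := by
  -- From `exp y ≤ 1 + y + y ^ 2` for `|y| ≤ 1`, which is where `θ ≤ 1` enters; the linear term
  -- vanishes by centring.
  have hfac : ∀ i n, ∑ s, q i n s * Real.exp (θ * v i n s) ≤ Real.exp (θ ^ 2) := by
    intro i n
    have h1 : ∀ s, q i n s * Real.exp (θ * v i n s) ≤
        q i n s * (1 + θ ^ 2) + θ * (q i n s * v i n s) := by
      intro s
      have hb : |θ * v i n s| ≤ 1 := by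
        rw [abs_mul, abs_of_nonneg hθ0]
        exact mul_le_one₀ hθ1 (abs_nonneg _) (hv i n s)
      have h2 := (abs_le.1 (Real.abs_exp_sub_one_sub_id_le hb)).2
      have h3 : (θ * v i n s) ^ 2 ≤ θ ^ 2 := by
        rw [mul_pow]
        have : v i n s ^ 2 ≤ 1 := by rw [sq_le_one_iff_abs_le_one]; exact hv i n s
        nlinarith [sq_nonneg θ]
      have h4 : Real.exp (θ * v i n s) ≤ (1 + θ ^ 2) + θ * v i n s := by linarith
      calc _ ≤ q i n s * ((1 + θ ^ 2) + θ * v i n s) := mul_le_mul_of_nonneg_left h4 (hq0 i n s)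
        _ = _ := by ring
    calc _ ≤ ∑ s, (q i n s * (1 + θ ^ 2) + θ * (q i n s * v i n s)) :=
          Finset.sum_le_sum fun s _ => h1 s
      _ = 1 + θ ^ 2 := by
          rw [Finset.sum_add_distrib, ← Finset.sum_mul, ← Finset.mul_sum, hq, hmean]; ring
      _ ≤ _ := by linarith [Real.add_one_le_exp (θ ^ 2)]
  have hprod : ∀ σ : ∀ i, Fin (m i) → X i, 0 ≤ ∏ i, ∏ n, q i n (σ i n) := fun σ =>
    Finset.prod_nonneg fun i _ => Finset.prod_nonneg fun n _ => hq0 i n _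
  -- Exponential Markov inequality: the indicator is at most the exponential of `θ` times the
  -- overshoot.
  calc _ ≤ ∑ σ : ∀ i, Fin (m i) → X i, (∏ i, ∏ n, q i n (σ i n)) *
        (Real.exp (θ * ∑ i, ∑ n, v i n (σ i n)) * Real.exp (-(θ * δ))) := by
        refine Finset.sum_le_sum fun σ _ => mul_le_mul_of_nonneg_left ?_ (hprod σ)
        split_ifs with h
        · rw [← Real.exp_add]
          apply Real.one_le_exp
          nlinarith
        · positivity
    _ = (∑ σ : ∀ i, Fin (m i) → X i,
          ∏ i, ∏ n, (q i n (σ i n) * Real.exp (θ * v i n (σ i n)))) * Real.exp (-(θ * δ)) := by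
        rw [Finset.sum_mul]
        refine Finset.sum_congr rfl fun σ _ => ?_
        simp only [Finset.prod_mul_distrib, Finset.mul_sum, Real.exp_sum]
        ring
    _ = (∏ i, ∏ n, ∑ s, q i n s * Real.exp (θ * v i n s)) * Real.exp (-(θ * δ)) := by
        rw [sum_prod_prod fun i n s => q i n s * Real.exp (θ * v i n s)]
    _ ≤ (∏ i, ∏ _n : Fin (m i), Real.exp (θ ^ 2)) * Real.exp (-(θ * δ)) := by
        have h0 : ∀ i n, 0 ≤ ∑ s, q i n s * Real.exp (θ * v i n s) := fun i n =>
          Finset.sum_nonneg fun s _ => mul_nonneg (hq0 i n s) (Real.exp_pos _).le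
        refine mul_le_mul_of_nonneg_right ?_ (Real.exp_pos _).le
        exact Finset.prod_le_prod (fun i _ => Finset.prod_nonneg fun n _ => h0 i n) fun i _ =>
          Finset.prod_le_prod (fun n _ => h0 i n) fun n _ => hfac i n
    _ = _ := by
        simp only [← Real.exp_sum, ← Real.exp_add, Finset.sum_const, Finset.card_univ,
          Fintype.card_fin, nsmul_eq_mul, ← Finset.sum_mul]
        congr 1
        ring

/-- Two-sided exponential tail bound for the deviation of a sum of independent variables with
values in `[0, 1]` from its mean. -/
theorem prod_weight_abs_tail (q : ∀ i, Fin (m i) → X i → ℝ) (hq0 : ∀ i n s, 0 ≤ q i n s)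
    (hq : ∀ i n, ∑ s, q i n s = 1) (u : ∀ i, X i → ℝ) (hu0 : ∀ i s, 0 ≤ u i s)
    (hu1 : ∀ i s, u i s ≤ 1) {θ : ℝ} (hθ0 : 0 ≤ θ) (hθ1 : θ ≤ 1) (δ : ℝ) :
    ∑ σ : ∀ i, Fin (m i) → X i, (∏ i, ∏ n, q i n (σ i n)) *
        (if δ < |∑ i, ∑ n, (u i (σ i n) - ∑ s, q i n s * u i s)| then 1 else 0) ≤
      2 * Real.exp (θ ^ 2 * ∑ i, (m i : ℝ) - θ * δ) := by
  have hm0 : ∀ i n, 0 ≤ ∑ s, q i n s * u i s := fun i n =>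
    Finset.sum_nonneg fun s _ => mul_nonneg (hq0 i n s) (hu0 i s)
  have hm1 : ∀ i n, ∑ s, q i n s * u i s ≤ 1 := fun i n => by
    rw [← hq i n]
    exact Finset.sum_le_sum fun s _ => mul_le_of_le_one_right (hq0 i n s) (hu1 i s)
  have hprod : ∀ σ : ∀ i, Fin (m i) → X i, 0 ≤ ∏ i, ∏ n, q i n (σ i n) := fun σ =>
    Finset.prod_nonneg fun i _ => Finset.prod_nonneg fun n _ => hq0 i n _
  have h1 := prod_weight_tail q hq0 hq (fun i n s => u i s - ∑ s', q i n s' * u i s')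
    (fun i n s => abs_le.2 ⟨by linarith [hu0 i s, hm1 i n], by linarith [hu1 i s, hm0 i n]⟩)
    (fun i n => by
      simp only [mul_sub, Finset.sum_sub_distrib, ← Finset.sum_mul, hq, one_mul, sub_self])
    hθ0 hθ1 δ
  have h2 := prod_weight_tail q hq0 hq (fun i n s => -(u i s - ∑ s', q i n s' * u i s'))
    (fun i n s => abs_le.2 ⟨by linarith [hu1 i s, hm0 i n], by linarith [hu0 i s, hm1 i n]⟩)
    (fun i n => by
      simp only [mul_neg, Finset.sum_neg_distrib, mul_sub, Finset.sum_sub_distrib,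
        ← Finset.sum_mul, hq, one_mul, sub_self, neg_zero])
    hθ0 hθ1 δ
  simp only [Finset.sum_neg_distrib] at h2
  refine le_trans ?_ ((add_le_add h1 h2).trans_eq (two_mul _).symm)
  rw [← Finset.sum_add_distrib]
  refine Finset.sum_le_sum fun σ _ => ?_
  rw [← mul_add]
  refine mul_le_mul_of_nonneg_left ?_ (hprod σ)
  by_cases hδ : δ < |∑ i, ∑ n, (u i (σ i n) - ∑ s, q i n s * u i s)|
  · rw [if_pos hδ]
    rcases lt_abs.1 hδ with h | h
    · rw [if_pos h]
      split_ifs <;> norm_num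
    · rw [if_pos h]
      split_ifs <;> norm_num
  · rw [if_neg hδ]
    split_ifs <;> norm_num

end ProductWeights

/-! ### Calculus of exponentially small sequences -/

section ExpSmall

/-- Eventually exponentially small sequences. -/
def ExpSmall (u : ℕ → ℝ) : Prop :=
  ∃ C : ℝ, 0 < C ∧ ∃ H : ℕ, ∀ n : ℕ, H < n → u n ≤ Real.exp (-C * n)

theorem ExpSmall.mono {u v : ℕ → ℝ} (hv : ExpSmall v) {H : ℕ} (huv : ∀ n, H < n → u n ≤ v n) :
    ExpSmall u := by
  obtain ⟨C, hC, H', h'⟩ := hv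
  exact ⟨C, hC, max H H', fun n hn => (huv n ((le_max_left _ _).trans_lt hn)).trans
    (h' n ((le_max_right _ _).trans_lt hn))⟩

/-- Half of the smaller rate is given up: once `D * n > 2`, the factor `exp (D / 2 * n)` exceeds
`2`. Prefactors and finite union bounds can thus be absorbed, as required by the target bound `exp
(-C * h)` without a constant in front. -/
theorem ExpSmall.add {u v : ℕ → ℝ} (hu : ExpSmall u) (hv : ExpSmall v) :
    ExpSmall fun n => u n + v n := by
  obtain ⟨C, hC, H, hu⟩ := hu
  obtain ⟨C', hC', H', hv⟩ := hv
  set D := min C C' with hD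
  have hDpos : 0 < D := lt_min hC hC'
  obtain ⟨k, hk⟩ := exists_nat_gt (2 / D)
  refine ⟨D / 2, by positivity, max (max H H') k, fun n hn => ?_⟩
  have hn1 : H < n := ((le_max_left _ _).trans (le_max_left _ _)).trans_lt hn
  have hn2 : H' < n := ((le_max_right _ _).trans (le_max_left _ _)).trans_lt hn
  have hn3 : (k : ℝ) < n := by exact_mod_cast (le_max_right _ _).trans_lt hn
  have hn0 : (0 : ℝ) ≤ n := Nat.cast_nonneg n
  have h1 : Real.exp (-C * n) ≤ Real.exp (-D * n) := Real.exp_le_exp.2 (by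
    have := mul_le_mul_of_nonneg_right (min_le_left C C') hn0
    linarith)
  have h2 : Real.exp (-C' * n) ≤ Real.exp (-D * n) := Real.exp_le_exp.2 (by
    have := mul_le_mul_of_nonneg_right (min_le_right C C') hn0
    linarith)
  have h3 : 2 < D * n := by
    have := hk.trans hn3
    rw [div_lt_iff₀ hDpos] at this
    linarith
  have h4 : 2 ≤ Real.exp (D / 2 * n) := by
    have := Real.add_one_le_exp (D / 2 * n)
    linarith
  have h5 : Real.exp (-(D / 2) * n) = Real.exp (-D * n) * Real.exp (D / 2 * n) := by
    rw [← Real.exp_add]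
    ring_nf
  rw [h5]
  have := mul_le_mul_of_nonneg_left h4 (Real.exp_pos (-D * n)).le
  linarith [hu n hn1, hv n hn2]

theorem ExpSmall.zero : ExpSmall fun _ => 0 :=
  ⟨1, one_pos, 0, fun _ _ => (Real.exp_pos _).le⟩

theorem ExpSmall.sum {κ : Type*} (F : Finset κ) {u : κ → ℕ → ℝ} (hu : ∀ k, ExpSmall (u k)) :
    ExpSmall fun n => ∑ k ∈ F, u k n := by
  classical
  induction F using Finset.induction_on with
  | empty => simpa using ExpSmall.zero
  | insert k F hk ih =>
    simp only [Finset.sum_insert hk]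
    exact (hu k).add ih

theorem ExpSmall.two_mul_exp {κ : ℝ} (hκ : 0 < κ) :
    ExpSmall fun n => 2 * Real.exp (-κ * n) := by
  have h1 : ExpSmall fun n : ℕ => Real.exp (-κ * n) := ⟨κ, hκ, 0, fun _ _ => le_rfl⟩
  simpa only [two_mul] using h1.add h1

end ExpSmall

/-! ### The law of the controlled process -/

section

variable {ι : Type*} {S A : ι → Type*} {L T h : ℕ}
  [Fintype ι] [DecidableEq ι]
  [∀ i, Fintype (S i)] [∀ i, DecidableEq (S i)]
  [∀ i, Fintype (A i)] [∀ i, DecidableEq (A i)]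

/-- The action law consists of probability vectors. -/
structure ActionLaw.IsStochastic {M : WCG ι S A L} (π : M.ActionLaw T h) : Prop where
  nonneg : ∀ t s a, 0 ≤ π t s a
  sum_one : ∀ t s, ∑ a, π t s a = 1

theorem Policy.isStochastic_law {M : WCG ι S A L} (φ : M.Policy T h) :
    φ.law.IsStochastic where
  nonneg t s a := by
    unfold Policy.law
    split_ifs <;> norm_num
  sum_one t s := by simp [Policy.law]

theorem trans_nonneg (M : WCG ι S A L) (s : M.State h) (a : M.Action h) (s' : M.State h) :
    0 ≤ M.trans s a s' :=
  Finset.prod_nonneg fun _ _ => Finset.prod_nonneg fun _ _ => M.p_nonneg _ _ _ _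

theorem sum_trans (M : WCG ι S A L) (s : M.State h) (a : M.Action h) :
    ∑ s', M.trans s a s' = 1 := by
  unfold trans
  rw [sum_prod_prod fun i n s' => M.p i (s i n) (a i n) s']
  simp [M.p_sum]

section Law

variable (M : WCG ι S A L) (s₀ : M.State h) (π : M.ActionLaw T h)

/-- Weight of the initial state-action pair. -/
def initWeight (q : M.State h × M.Action h) : ℝ :=
  if q.1 = s₀ then π 0 q.1 q.2 else 0

/-- Transition kernel of the state-action process. -/
def kernel (t : Fin T) (q q' : M.State h × M.Action h) : ℝ :=
  M.trans q.1 q.2 q'.1 * π t.succ q'.1 q'.2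

/-- State-action pairs form a Markov chain once the action law at the arrival time is included in
the kernel and that at time `0` in the initial weight. The path-sum lemmas then apply. -/
theorem trajProb_eq (ω : M.Traj T h) :
    M.trajProb s₀ π ω =
      M.initWeight s₀ π (ω 0) * ∏ t : Fin T, M.kernel π t (ω t.castSucc) (ω t.succ) := by
  unfold trajProb initWeight kernel
  split_ifs
  · rw [Fin.prod_univ_succ, Finset.prod_mul_distrib]
    ring
  · simp

variable {π} (hπ : π.IsStochastic)
include hπ

theorem sum_kernel_mul (t : Fin T) (q : M.State h × M.Action h) (g : M.State h → ℝ) :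
    ∑ q', M.kernel π t q q' * g q'.1 = ∑ s', M.trans q.1 q.2 s' * g s' := by
  rw [Fintype.sum_prod_type]
  refine Finset.sum_congr rfl fun s' _ => ?_
  simp only [kernel]
  rw [← Finset.sum_mul, ← Finset.mul_sum, hπ.sum_one, mul_one]

theorem sum_kernel (t : Fin T) (q : M.State h × M.Action h) : ∑ q', M.kernel π t q q' = 1 := by
  have := M.sum_kernel_mul hπ t q fun _ => 1
  simpa [sum_trans] using this

theorem trajProb_nonneg (ω : M.Traj T h) : 0 ≤ M.trajProb s₀ π ω := by
  unfold trajProb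
  split_ifs
  · exact mul_nonneg (Finset.prod_nonneg fun _ _ => hπ.nonneg _ _ _)
      (Finset.prod_nonneg fun _ _ => M.trans_nonneg _ _ _)
  · exact le_rfl

theorem sum_trajProb : ∑ ω, M.trajProb s₀ π ω = 1 := by
  simp only [trajProb_eq]
  rw [sum_pathWeight (M.initWeight s₀ π) (M.kernel π) (M.sum_kernel hπ), Fintype.sum_prod_type]
  simp only [initWeight]
  rw [Finset.sum_eq_single s₀]
  · simp [hπ.sum_one]
  · intro s _ hs
    simp [hs]
  · simp

/-- Conditioning the state at the next time on the current states and actions. -/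
theorem expect_step (t : Fin T) (g : M.State h × M.Action h → M.State h → ℝ) :
    M.expect s₀ π (fun ω => g (ω t.castSucc) (ω t.succ).1) =
      M.expect s₀ π fun ω =>
        ∑ s', M.trans (ω t.castSucc).1 (ω t.castSucc).2 s' * g (ω t.castSucc) s' := by
  unfold expect
  simp only [trajProb_eq]
  rw [sum_pathWeight_step (M.initWeight s₀ π) (M.kernel π) (M.sum_kernel hπ) t
    fun q q' => g q q'.1]
  simp only [M.sum_kernel_mul hπ]

/-- Conditioning the actions on the current states. -/
theorem expect_action (t : Fin (T + 1)) (g : M.State h → M.Action h → ℝ) :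
    M.expect s₀ π (fun ω => g (ω t).1 (ω t).2) =
      M.expect s₀ π fun ω => ∑ a, π t (ω t).1 a * g (ω t).1 a := by
  have hk : ∀ (t : Fin T) (q : M.State h × M.Action h) (F : M.State h → M.Action h → ℝ),
      ∑ q', M.kernel π t q q' * F q'.1 q'.2 =
        ∑ s', M.trans q.1 q.2 s' * ∑ a, π t.succ s' a * F s' a := by
    intro t q F
    rw [Fintype.sum_prod_type]
    simp only [kernel, Finset.mul_sum, mul_assoc]
  unfold expect
  simp only [trajProb_eq]
  induction t using Fin.cases with
  | zero =>
    have h1 := sum_pathWeight (fun q => M.initWeight s₀ π q * g q.1 q.2) (M.kernel π)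
      (M.sum_kernel hπ)
    have h2 := sum_pathWeight (fun q => M.initWeight s₀ π q * ∑ a, π 0 q.1 a * g q.1 a)
      (M.kernel π) (M.sum_kernel hπ)
    simp only [mul_right_comm _ _ (∏ t : Fin T, _)] at h1 h2
    rw [h1, h2, Fintype.sum_prod_type, Fintype.sum_prod_type]
    refine Finset.sum_congr rfl fun s _ => ?_
    simp only [initWeight]
    rw [← Finset.sum_mul]
    split_ifs with hs
    · rw [hπ.sum_one, one_mul]
    · simp
  | succ t =>
    -- Both sides are conditioned on the previous pair; their integrals against the kernel agree by
    -- `hk`.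
    rw [sum_pathWeight_step (M.initWeight s₀ π) (M.kernel π) (M.sum_kernel hπ) t
        fun _ q' => g q'.1 q'.2,
      sum_pathWeight_step (M.initWeight s₀ π) (M.kernel π) (M.sum_kernel hπ) t
        fun _ q' => ∑ a, π t.succ q'.1 a * g q'.1 a]
    refine Finset.sum_congr rfl fun ω _ => ?_
    rw [hk, M.sum_kernel_mul hπ t _ fun s => ∑ a, π t.succ s a * g s a]

theorem expect_const (k : ℝ) : M.expect s₀ π (fun _ => k) = k := by
  unfold expect
  rw [← Finset.sum_mul, M.sum_trajProb s₀ hπ, one_mul]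

/-- Trajectories of weight zero are exempt, so a comparison may use properties that hold only almost
surely, such as the constraints under a feasible policy. -/
theorem expect_mono_ae {X X' : M.Traj T h → ℝ}
    (hX : ∀ ω, M.trajProb s₀ π ω ≠ 0 → X ω ≤ X' ω) : M.expect s₀ π X ≤ M.expect s₀ π X' := by
  refine Finset.sum_le_sum fun ω _ => ?_
  by_cases h0 : M.trajProb s₀ π ω = 0
  · simp [h0]
  · exact mul_le_mul_of_nonneg_left (hX ω h0) (M.trajProb_nonneg s₀ hπ ω)

theorem expect_mono {X X' : M.Traj T h → ℝ} (hX : ∀ ω, X ω ≤ X' ω) :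
    M.expect s₀ π X ≤ M.expect s₀ π X' :=
  M.expect_mono_ae s₀ hπ fun ω _ => hX ω

theorem prob_mono_ae {E E' : Set (M.Traj T h)}
    (hE : ∀ ω, M.trajProb s₀ π ω ≠ 0 → ω ∈ E → ω ∈ E') :
    M.prob s₀ π E ≤ M.prob s₀ π E' := by
  classical
  refine Finset.sum_le_sum fun ω _ => ?_
  by_cases h0 : M.trajProb s₀ π ω = 0
  · simp [Set.indicator_apply, h0]
  · simp only [Set.indicator_apply]
    have := M.trajProb_nonneg s₀ hπ ω
    have := hE ω h0
    split_ifs <;> tauto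

theorem prob_mono {E E' : Set (M.Traj T h)} (hE : E ⊆ E') :
    M.prob s₀ π E ≤ M.prob s₀ π E' :=
  M.prob_mono_ae s₀ hπ fun _ _ h => hE h

theorem prob_nonneg (E : Set (M.Traj T h)) : 0 ≤ M.prob s₀ π E :=
  Finset.sum_nonneg fun ω _ => Set.indicator_nonneg (fun ω _ => M.trajProb_nonneg s₀ hπ ω) ω

theorem prob_union_le (E E' : Set (M.Traj T h)) :
    M.prob s₀ π (E ∪ E') ≤ M.prob s₀ π E + M.prob s₀ π E' := by
  classical
  unfold prob
  rw [← Finset.sum_add_distrib]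
  refine Finset.sum_le_sum fun ω _ => ?_
  have := M.trajProb_nonneg s₀ hπ ω
  simp only [Set.indicator_apply, Set.mem_union]
  split_ifs <;> first | linarith | tauto

theorem prob_exists_le {κ : Type*} (F : Finset κ) (E : κ → Set (M.Traj T h)) :
    M.prob s₀ π {ω | ∃ k ∈ F, ω ∈ E k} ≤ ∑ k ∈ F, M.prob s₀ π (E k) := by
  classical
  induction F using Finset.induction_on with
  | empty => simp [prob]
  | insert k F hk ih =>
    rw [Finset.sum_insert hk]
    calc _ ≤ M.prob s₀ π (E k ∪ {ω | ∃ k ∈ F, ω ∈ E k}) :=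
          M.prob_mono s₀ hπ fun ω hω => by
            simp only [Finset.mem_insert, Set.mem_ofPred_eq, Set.mem_union] at hω ⊢
            obtain ⟨k', rfl | h1, h2⟩ := hω
            · exact Or.inl h2
            · exact Or.inr ⟨k', h1, h2⟩
      _ ≤ _ := (M.prob_union_le s₀ hπ _ _).trans (by gcongr)

theorem prob_setOf_eq_expect (Q : M.Traj T h → Prop) [DecidablePred Q] :
    M.prob s₀ π {ω | Q ω} = M.expect s₀ π fun ω => if Q ω then 1 else 0 := by
  unfold prob expect
  refine Finset.sum_congr rfl fun ω _ => ?_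
  simp only [Set.indicator_apply, Set.mem_ofPred_eq]
  split_ifs <;> simp

/-- A variable that is bounded by `ε` outside of an event and by `B` on it. -/
theorem abs_expect_le {X : M.Traj T h → ℝ} {ε B : ℝ} (E : Set (M.Traj T h)) (hε : 0 ≤ ε)
    (h1 : ∀ ω, ω ∉ E → |X ω| ≤ ε) (h2 : ∀ ω, |X ω| ≤ B) :
    |M.expect s₀ π X| ≤ B * M.prob s₀ π E + ε := by
  classical
  have hE := M.prob_setOf_eq_expect s₀ hπ (· ∈ E)
  rw [Set.ofPred_mem_eq] at hE
  calc |M.expect s₀ π X| ≤ ∑ ω, |M.trajProb s₀ π ω * X ω| := Finset.abs_sum_le_sum_abs _ _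
    _ ≤ ∑ ω, (B * (M.trajProb s₀ π ω * (if ω ∈ E then 1 else 0)) + M.trajProb s₀ π ω * ε) := by
        refine Finset.sum_le_sum fun ω _ => ?_
        have h0 := M.trajProb_nonneg s₀ hπ ω
        rw [abs_mul, abs_of_nonneg h0]
        split_ifs with hω
        · nlinarith [mul_le_mul_of_nonneg_left (h2 ω) h0]
        · nlinarith [mul_le_mul_of_nonneg_left (h1 ω hω) h0]
    _ = _ := by
        rw [Finset.sum_add_distrib, ← Finset.mul_sum, ← Finset.sum_mul, M.sum_trajProb s₀ hπ, hE,
          one_mul]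
        rfl

end Law

section ExpectLinear

variable (M : WCG ι S A L) (s₀ : M.State h) (π : M.ActionLaw T h)

theorem expect_sum {κ : Type*} (F : Finset κ) (X : κ → M.Traj T h → ℝ) :
    M.expect s₀ π (fun ω => ∑ k ∈ F, X k ω) = ∑ k ∈ F, M.expect s₀ π (X k) := by
  unfold expect
  simp only [Finset.mul_sum]
  exact Finset.sum_comm

theorem expect_mul_const (X : M.Traj T h → ℝ) (k : ℝ) :
    M.expect s₀ π (fun ω => X ω * k) = M.expect s₀ π X * k := by
  simp only [expect, Finset.sum_mul, mul_assoc]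

theorem expect_sub (X X' : M.Traj T h → ℝ) :
    M.expect s₀ π (fun ω => X ω - X' ω) = M.expect s₀ π X - M.expect s₀ π X' := by
  simp only [expect, mul_sub, Finset.sum_sub_distrib]

theorem expect_congr_ae {X X' : M.Traj T h → ℝ}
    (hX : ∀ ω, M.trajProb s₀ π ω ≠ 0 → X ω = X' ω) : M.expect s₀ π X = M.expect s₀ π X' := by
  refine Finset.sum_congr rfl fun ω _ => ?_
  by_cases h0 : M.trajProb s₀ π ω = 0
  · simp [h0]
  · rw [hX ω h0]

theorem initial_state_of_trajProb_ne_zero {ω : M.Traj T h} (hω : M.trajProb s₀ π ω ≠ 0) :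
    (ω 0).1 = s₀ := by
  by_contra hne
  exact hω (by simp [trajProb, hne])

theorem action_of_trajProb_ne_zero {φ : M.Policy T h} {ω : M.Traj T h}
    (hω : M.trajProb s₀ φ.law ω ≠ 0) (t : Fin (T + 1)) : (ω t).2 = φ t (ω t).1 := by
  by_contra hne
  apply hω
  unfold trajProb
  split_ifs
  · rw [Finset.prod_eq_zero (Finset.mem_univ t) (by simp [Policy.law, hne]), zero_mul]
  · rfl

end ExpectLinear

/-! ### Occupation counts and their one-step means -/

section Counts

variable (M : WCG ι S A L)

theorem stateCount_eq_sum (σ : M.State h) (i : ι) (s : S i) :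
    (M.stateCount σ i s : ℝ) = ∑ n, if σ i n = s then 1 else 0 := by
  simp [stateCount]

theorem gsaCount_eq_sum (σ : M.State h) (α : M.Action h) (j : GSA S A) :
    (M.gsaCount σ α j : ℝ) =
      ∑ n, (if σ j.1 n = j.2.1 then 1 else 0) * (if α j.1 n = j.2.2 then 1 else 0) := by
  simp [gsaCount, ← ite_and, and_comm]

/-- Summation over processes by means of the counts of state-action pairs. -/
theorem sum_gsaCount_mul (σ : M.State h) (α : M.Action h) (i : ι) (g : S i → A i → ℝ) :
    ∑ s, ∑ a, (M.gsaCount σ α ⟨i, s, a⟩ : ℝ) * g s a = ∑ n, g (σ i n) (α i n) := by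
  simp only [gsaCount_eq_sum, Finset.sum_mul]
  have : ∀ s, ∑ a, ∑ n, (if σ i n = s then (1 : ℝ) else 0) * (if α i n = a then 1 else 0) * g s a
      = ∑ n, ∑ a, (if σ i n = s then (1 : ℝ) else 0) * (if α i n = a then 1 else 0) * g s a :=
    fun s => Finset.sum_comm
  simp only [this]
  rw [Finset.sum_comm]
  refine Finset.sum_congr rfl fun n _ => ?_
  simp

theorem sum_gsa {g : GSA S A → ℝ} : ∑ j, g j = ∑ i, ∑ s, ∑ a, g ⟨i, s, a⟩ := by
  rw [Fintype.sum_sigma]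
  simp only [Fintype.sum_prod_type]

theorem sum_gsaCount (σ : M.State h) (α : M.Action h) (i : ι) (s : S i) :
    ∑ a, (M.gsaCount σ α ⟨i, s, a⟩ : ℝ) = M.stateCount σ i s := by
  have h1 : ∀ a, (M.gsaCount σ α ⟨i, s, a⟩ : ℝ) = ∑ n : Fin (h * M.N₀ i),
      (if σ i n = s then 1 else 0) * (if α i n = a then 1 else 0) := fun a =>
    M.gsaCount_eq_sum σ α ⟨i, s, a⟩
  simp only [h1, stateCount_eq_sum]
  rw [Finset.sum_comm]
  simp

theorem sum_stateCount (σ : M.State h) (i : ι) :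
    ∑ s, (M.stateCount σ i s : ℝ) = h * M.N₀ i := by
  simp only [stateCount_eq_sum]
  rw [Finset.sum_comm]
  simp

theorem gsaCount_le (σ : M.State h) (α : M.Action h) (j : GSA S A) :
    M.gsaCount σ α j ≤ h * M.N₀ j.1 :=
  (Finset.card_le_univ _).trans (by simp)

theorem total_pos (i : ι) : 0 < M.total :=
  (M.N₀_pos i).trans_le (Finset.single_le_sum (fun _ _ => Nat.zero_le _) (Finset.mem_univ i))

theorem excess_gsaCount (σ : M.State h) (α : M.Action h) (ℓ : Fin L) :
    M.excess ℓ (M.gsaCount σ α) = ∑ i, ∑ n, M.f i ℓ (σ i n) (α i n) := by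
  unfold excess
  rw [sum_gsa]
  exact Finset.sum_congr rfl fun i _ => M.sum_gsaCount_mul σ α i (M.f i ℓ)

theorem pathReward_eq (ω : M.Traj T h) :
    M.pathReward ω =
      ∑ t, ∑ j : GSA S A, M.r j.1 j.2.1 j.2.2 * ((M.gsaCount (ω t).1 (ω t).2 j : ℝ) / h) := by
  unfold pathReward
  rw [Finset.sum_div]
  refine Finset.sum_congr rfl fun t _ => ?_
  rw [sum_gsa, Finset.sum_div]
  refine Finset.sum_congr rfl fun i _ => ?_
  rw [← M.sum_gsaCount_mul _ _ i (M.r i), Finset.sum_div]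
  refine Finset.sum_congr rfl fun s _ => ?_
  rw [Finset.sum_div]
  exact Finset.sum_congr rfl fun a _ => by ring

theorem sum_trans_mul_stateCount (σ : M.State h) (α : M.Action h) (i : ι) (s : S i) :
    ∑ σ', M.trans σ α σ' * (M.stateCount σ' i s : ℝ) =
      ∑ s', ∑ a', (M.gsaCount σ α ⟨i, s', a'⟩ : ℝ) * M.p i s' a' s := by
  rw [M.sum_gsaCount_mul σ α i fun s' a' => M.p i s' a' s]
  simp only [stateCount_eq_sum, Finset.mul_sum]
  rw [Finset.sum_comm]
  refine Finset.sum_congr rfl fun n _ => ?_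
  -- The lemma takes functions on the state spaces of all gangs; the indicator of `s` is transported
  -- along `i' = i` and extended by zero.
  have := sum_prod_prod_mul_apply (fun i n s' => M.p i (σ i n) (α i n) s')
    (fun i n => M.p_sum i _ _) i n fun i' s' =>
      if h : i' = i then if h ▸ s' = s then 1 else 0 else 0
  simpa [trans] using this

end Counts

/-! ### Expected counts and the LP upper bound -/

section Means

variable (M : WCG ι S A L) (s₀ : M.State h) {π : M.ActionLaw T h}

theorem expect_stateCount_succ (hπ : π.IsStochastic) (t : Fin T) (i : ι) (s : S i) :
    M.expect s₀ π (fun ω => (M.stateCount (ω t.succ).1 i s : ℝ)) =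
      ∑ s', ∑ a', M.expect s₀ π
        (fun ω => (M.gsaCount (ω t.castSucc).1 (ω t.castSucc).2 ⟨i, s', a'⟩ : ℝ)) *
          M.p i s' a' s := by
  rw [M.expect_step s₀ hπ t fun _ σ => (M.stateCount σ i s : ℝ)]
  simp only [sum_trans_mul_stateCount, expect_sum, expect_mul_const]

theorem expect_stateCount_zero (hπ : π.IsStochastic) (i : ι) (s : S i) :
    M.expect s₀ π (fun ω => (M.stateCount (ω 0).1 i s : ℝ)) = M.stateCount s₀ i s := by
  rw [M.expect_congr_ae s₀ π (X' := fun _ => (M.stateCount s₀ i s : ℝ)) fun ω hω => by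
    rw [M.initial_state_of_trajProb_ne_zero s₀ π hω]]
  exact M.expect_const s₀ hπ _

theorem sum_expect_gsaCount (t : Fin (T + 1)) (i : ι) (s : S i) :
    ∑ a, M.expect s₀ π (fun ω => (M.gsaCount (ω t).1 (ω t).2 ⟨i, s, a⟩ : ℝ)) =
      M.expect s₀ π (fun ω => (M.stateCount (ω t).1 i s : ℝ)) := by
  rw [← expect_sum]
  simp only [sum_gsaCount]

theorem stateCount_eq_of_Y {y₀ : ∀ i, S i → ℝ} (hh : 0 < h) (hs₀ : M.Y s₀ = y₀) (i : ι) (s : S i) :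
    (M.stateCount s₀ i s : ℝ) = h * M.total * y₀ i s := by
  have h1 : (0 : ℝ) < h := by exact_mod_cast hh
  have h2 : (0 : ℝ) < M.total := by exact_mod_cast M.total_pos i
  rw [← hs₀, Y]
  field_simp

/-- The normalised expected occupation numbers of a feasible policy are feasible for the linear
program. -/
theorem Feasible.lpFeasible {y₀ : ∀ i, S i → ℝ} (hh : 0 < h) (hs₀ : M.Y s₀ = y₀)
    {φ : M.Policy T h} (hφ : M.Feasible s₀ φ) :
    M.LPFeasible y₀ fun t (j : GSA S A) =>
      M.expect s₀ φ.law (fun ω => (M.gsaCount (ω t).1 (ω t).2 j : ℝ)) / (h * M.N₀ j.1) := by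
  have h1 : (0 : ℝ) < h := by exact_mod_cast hh
  have h2 : ∀ i, (0 : ℝ) < M.N₀ i := fun i => by exact_mod_cast M.N₀_pos i
  have hπ := φ.isStochastic_law
  constructor
  · intro t j
    have h3 : 0 < (h : ℝ) * M.N₀ j.1 := mul_pos h1 (h2 _)
    have h4 := M.expect_mono s₀ hπ (X := fun _ => 0)
      (X' := fun ω => (M.gsaCount (ω t).1 (ω t).2 j : ℝ)) fun ω => Nat.cast_nonneg _
    have h5 := M.expect_mono s₀ hπ (X := fun ω => (M.gsaCount (ω t).1 (ω t).2 j : ℝ))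
      (X' := fun _ => (h : ℝ) * M.N₀ j.1) fun ω => by exact_mod_cast M.gsaCount_le _ _ _
    rw [expect_const M s₀ hπ] at h4 h5
    exact ⟨by positivity, (div_le_one h3).2 h5⟩
  · intro t i s
    dsimp only
    rw [← Finset.sum_div, M.sum_expect_gsaCount, M.expect_stateCount_succ s₀ hπ, Finset.sum_div]
    refine Finset.sum_congr rfl fun s' _ => ?_
    rw [Finset.sum_div]
    exact Finset.sum_congr rfl fun a _ => by ring
  · intro t i
    simp only [← Finset.sum_div, M.sum_expect_gsaCount]
    rw [← expect_sum]
    simp only [sum_stateCount]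
    rw [expect_const M s₀ hπ, div_self (mul_pos h1 (h2 i)).ne']
  · intro i s
    dsimp only
    rw [← Finset.sum_div, M.sum_expect_gsaCount, M.expect_stateCount_zero s₀ hπ,
      M.stateCount_eq_of_Y s₀ hh hs₀]
    have := h2 i
    field_simp
  · intro ℓ t
    -- The gang sizes cancel, leaving the expected excess divided by `h`; feasibility makes the
    -- excess nonpositive almost surely.
    have h3 : ∑ j : GSA S A, (M.N₀ j.1 : ℝ) *
        (M.expect s₀ φ.law (fun ω => (M.gsaCount (ω t).1 (ω t).2 j : ℝ)) / (h * M.N₀ j.1)) *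
          M.f j.1 ℓ j.2.1 j.2.2 =
        M.expect s₀ φ.law (fun ω => M.excess ℓ (M.gsaCount (ω t).1 (ω t).2)) / h := by
      unfold excess
      rw [expect_sum, Finset.sum_div]
      refine Finset.sum_congr rfl fun j _ => ?_
      rw [expect_mul_const]
      have := h2 j.1
      field_simp
    rw [h3]
    refine div_nonpos_of_nonpos_of_nonneg ?_ h1.le
    have h4 := M.expect_mono_ae s₀ hπ (X' := fun _ => 0)
      (X := fun ω => M.excess ℓ (M.gsaCount (ω t).1 (ω t).2)) fun ω hω => by
        rw [excess_gsaCount]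
        exact hφ ω hω t ℓ
    rwa [expect_const M s₀ hπ] at h4

/-- The value of a feasible policy is bounded by the value of the linear program. -/
theorem Feasible.value_le {y₀ : ∀ i, S i → ℝ} (hh : 0 < h) (hs₀ : M.Y s₀ = y₀)
    {x : Fin (T + 1) → GSA S A → ℝ} (hx : M.LPOptimal y₀ x)
    {φ : M.Policy T h} (hφ : M.Feasible s₀ φ) : M.value s₀ φ.law ≤ M.lpValue x := by
  refine le_of_eq_of_le ?_ (hx.2 _ (hφ.lpFeasible M s₀ hh hs₀))
  unfold value lpValue
  rw [show M.pathReward = fun ω : M.Traj T h => _ from funext M.pathReward_eq, expect_sum]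
  refine Finset.sum_congr rfl fun t _ => ?_
  rw [expect_sum]
  refine Finset.sum_congr rfl fun j _ => ?_
  have h1 : (0 : ℝ) < h := by exact_mod_cast hh
  have h2 : (0 : ℝ) < M.N₀ j.1 := by exact_mod_cast M.N₀_pos _
  have h3 : (fun ω : M.Traj T h =>
      M.r j.1 j.2.1 j.2.2 * ((M.gsaCount (ω t).1 (ω t).2 j : ℝ) / h)) =
      fun ω => (M.gsaCount (ω t).1 (ω t).2 j : ℝ) * (M.r j.1 j.2.1 j.2.2 / h) := by
    funext ω
    ring
  rw [h3, expect_mul_const]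
  field_simp

end Means

/-! ### The randomised policy realises the LP point -/

section FluidPolicy

variable (M : WCG ι S A L) {x : Fin (T + 1) → GSA S A → ℝ} {y₀ : ∀ i, S i → ℝ}

theorem alphaLP_nonneg (hx : ∀ t j, 0 ≤ x t j) (t : Fin (T + 1)) (i : ι) (s : S i) (a : A i) :
    0 ≤ alphaLP x t i s a := by
  unfold alphaLP
  split_ifs with h
  · exact div_nonneg (hx _ _) h.le
  · positivity

theorem sum_alphaLP (t : Fin (T + 1)) (i : ι) (s : S i) [Nonempty (A i)] :
    ∑ a, alphaLP x t i s a = 1 := by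
  unfold alphaLP
  split_ifs with h
  · rw [← Finset.sum_div, div_self h.ne']
  · simp

/-- The default value of `alphaLP` does no harm: nonnegative entries with sum zero all vanish, so
both sides are zero. -/
theorem alphaLP_mul_sum (hx : ∀ t j, 0 ≤ x t j) (t : Fin (T + 1)) (i : ι) (s : S i) (a : A i) :
    alphaLP x t i s a * ∑ a', x t ⟨i, s, a'⟩ = x t ⟨i, s, a⟩ := by
  unfold alphaLP
  split_ifs with h
  · rw [div_mul_cancel₀ _ h.ne']
  · have h0 : ∑ a', x t ⟨i, s, a'⟩ = 0 :=
      le_antisymm (not_lt.1 h) (Finset.sum_nonneg fun _ _ => hx _ _)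
    rw [h0, mul_zero]
    exact ((Finset.sum_eq_zero_iff_of_nonneg fun _ _ => hx _ _).1 h0 a (Finset.mem_univ a)).symm

theorem isStochastic_lpPolicy (hx : ∀ t j, 0 ≤ x t j) [∀ i, Nonempty (A i)] :
    (M.lpPolicy x h).IsStochastic where
  nonneg t σ α := Finset.prod_nonneg fun i _ => Finset.prod_nonneg fun n _ =>
    alphaLP_nonneg hx _ _ _ _
  sum_one t σ := by
    unfold lpPolicy
    rw [sum_prod_prod fun i n a => alphaLP x t i (σ i n) a]
    simp [sum_alphaLP]

theorem sum_lpPolicy_mul_gsaCount [∀ i, Nonempty (A i)] (t : Fin (T + 1)) (σ : M.State h)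
    (j : GSA S A) :
    ∑ α, M.lpPolicy x h t σ α * (M.gsaCount σ α j : ℝ) =
      M.stateCount σ j.1 j.2.1 * alphaLP x t j.1 j.2.1 j.2.2 := by
  obtain ⟨i, s, a⟩ := j
  simp only [gsaCount_eq_sum, stateCount_eq_sum, Finset.mul_sum, Finset.sum_mul]
  rw [Finset.sum_comm]
  refine Finset.sum_congr rfl fun n _ => ?_
  have := sum_prod_prod_mul_apply (fun i n a => alphaLP x t i (σ i n) a)
    (fun i n => sum_alphaLP t i _) i n fun i' a' =>
      if h : i' = i then if h ▸ a' = a then 1 else 0 else 0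
  simp only [dite_true] at this
  simp only [mul_left_comm _ (if σ i n = s then (1 : ℝ) else 0) _]
  rw [← Finset.mul_sum]
  simp only [lpPolicy]
  rw [this]
  by_cases hs : σ i n = s
  · simp [hs]
  · simp [hs]

variable (s₀ : M.State h)

/-- Expected counts and the LP point obey the same linear recursion: multiplication by `alphaLP`
passes from states to triples, and the flow equation passes to the next time. Their initial values
agree as well. -/
theorem expect_gsaCount_lpPolicy [∀ i, Nonempty (A i)] (hh : 0 < h) (hs₀ : M.Y s₀ = y₀)
    (hx : M.LPFeasible y₀ x) (t : Fin (T + 1)) (j : GSA S A) :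
    M.expect s₀ (M.lpPolicy x h) (fun ω => (M.gsaCount (ω t).1 (ω t).2 j : ℝ)) =
      h * M.N₀ j.1 * x t j := by
  have hx0 : ∀ t j, 0 ≤ x t j := fun t j => (hx.mem_Icc t j).1
  have hπ := M.isStochastic_lpPolicy (h := h) hx0
  have hstep : ∀ t (j : GSA S A),
      M.expect s₀ (M.lpPolicy x h) (fun ω => (M.stateCount (ω t).1 j.1 j.2.1 : ℝ)) =
        h * M.N₀ j.1 * ∑ a, x t ⟨j.1, j.2.1, a⟩ →
      M.expect s₀ (M.lpPolicy x h) (fun ω => (M.gsaCount (ω t).1 (ω t).2 j : ℝ)) =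
        h * M.N₀ j.1 * x t j := by
    intro t j hj
    rw [M.expect_action s₀ hπ t fun σ α => (M.gsaCount σ α j : ℝ)]
    simp only [sum_lpPolicy_mul_gsaCount, expect_mul_const, hj]
    rw [← alphaLP_mul_sum hx0 t j.1 j.2.1 j.2.2]
    ring
  apply hstep
  induction t using Fin.induction generalizing j with
  | zero =>
    have h2 : (0 : ℝ) < M.N₀ j.1 := by exact_mod_cast M.N₀_pos _
    rw [M.expect_stateCount_zero s₀ hπ, M.stateCount_eq_of_Y s₀ hh hs₀, hx.init]
    field_simp
  | succ t ih =>
    rw [M.expect_stateCount_succ s₀ hπ, ← hx.flow, Finset.mul_sum]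
    refine Finset.sum_congr rfl fun s' _ => ?_
    rw [Finset.mul_sum]
    refine Finset.sum_congr rfl fun a' _ => ?_
    rw [hstep t.castSucc ⟨j.1, s', a'⟩ (ih _)]
    ring

theorem meanZ_lpPolicy [∀ i, Nonempty (A i)] (hh : 0 < h) (hs₀ : M.Y s₀ = y₀)
    (hx : M.LPFeasible y₀ x) (t : Fin (T + 1)) (j : GSA S A) :
    M.meanZ s₀ (M.lpPolicy x h) t j = M.N₀ j.1 * x t j / M.total := by
  have h1 : (0 : ℝ) < h := by exact_mod_cast hh
  have h2 : (0 : ℝ) < M.total := by exact_mod_cast M.total_pos j.1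
  unfold meanZ Z
  simp only [div_eq_mul_inv _ ((h : ℝ) * M.total)]
  rw [expect_mul_const, M.expect_gsaCount_lpPolicy s₀ hh hs₀ hx]
  field_simp

end FluidPolicy

/-! ### The repair moves few processes -/

section Moves

variable (M : WCG ι S A L)

/-- The bound on `n` keeps the natural subtraction from truncating, and `a ≠ b` separates source and
target. In this additive form all effects of a transfer are linear. -/
theorem cast_transfer (i : ι) (s : S i) {a b : A i} (hab : a ≠ b) {n : ℕ} {K : GSA S A → ℕ}
    (hn : n ≤ K ⟨i, s, a⟩) (j : GSA S A) :
    (transfer i s a b n K j : ℝ) =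
      K j + ((if j = ⟨i, s, b⟩ then (n : ℝ) else 0) - if j = ⟨i, s, a⟩ then (n : ℝ) else 0) := by
  have hne : (⟨i, s, a⟩ : GSA S A) ≠ ⟨i, s, b⟩ := by
    intro he
    simp only [Sigma.mk.injEq, heq_eq_eq, Prod.mk.injEq, true_and] at he
    exact hab he
  unfold transfer
  split_ifs with h1 h2 h2
  · exact absurd (h1.symm.trans h2) hne
  · subst h1
    rw [Nat.cast_sub hn]
    ring
  · push_cast
    ring
  · ring

theorem excess_transfer (ℓ : Fin L) (i : ι) (s : S i) {a b : A i} (hab : a ≠ b) {n : ℕ}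
    {K : GSA S A → ℕ} (hn : n ≤ K ⟨i, s, a⟩) :
    M.excess ℓ (transfer i s a b n K) = M.excess ℓ K - n * (M.f i ℓ s a - M.f i ℓ s b) := by
  unfold excess
  simp only [cast_transfer i s hab hn, add_mul, sub_mul, ite_mul, zero_mul,
    Finset.sum_add_distrib, Finset.sum_sub_distrib]
  rw [Finset.sum_ite_eq' Finset.univ (⟨i, s, b⟩ : GSA S A)
      fun j => (n : ℝ) * M.f j.1 ℓ j.2.1 j.2.2,
    Finset.sum_ite_eq' Finset.univ (⟨i, s, a⟩ : GSA S A)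
      fun j => (n : ℝ) * M.f j.1 ℓ j.2.1 j.2.2]
  simp only [Finset.mem_univ, if_true]
  ring

theorem sum_transfer (i : ι) (s : S i) {a b : A i} (hab : a ≠ b) {n : ℕ} {K : GSA S A → ℕ}
    (hn : n ≤ K ⟨i, s, a⟩) (i' : ι) (s' : S i') :
    ∑ a', transfer i s a b n K ⟨i', s', a'⟩ = ∑ a', K ⟨i', s', a'⟩ := by
  have key : ∀ d : A i, ∑ a' : A i',
      (if (⟨i', s', a'⟩ : GSA S A) = ⟨i, s, d⟩ then (n : ℝ) else 0) =
      if (⟨i', s'⟩ : Σ i, S i) = ⟨i, s⟩ then (n : ℝ) else 0 := by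
    intro d
    by_cases hi : i' = i
    · subst hi
      by_cases hs : s' = s
      · subst hs
        simp
      · simp [hs]
    · simp [hi]
  have : ((∑ a', transfer i s a b n K ⟨i', s', a'⟩ : ℕ) : ℝ) = ∑ a', (K ⟨i', s', a'⟩ : ℝ) := by
    push_cast
    simp only [cast_transfer i s hab hn, Finset.sum_add_distrib, Finset.sum_sub_distrib, key]
    ring
  exact_mod_cast this

/-- A bound for the inverses of all positive differences of constraint functions. -/
noncomputable def gapConst : ℝ :=
  -- Vanishing differences contribute `0⁻¹ = 0`, so no case distinction is needed for ties.
  ∑ ℓ : Fin L, ∑ j : GSA S A, ∑ b, |M.f j.1 ℓ j.2.1 j.2.2 - M.f j.1 ℓ j.2.1 b|⁻¹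

theorem gapConst_nonneg : 0 ≤ M.gapConst :=
  Finset.sum_nonneg fun _ _ => Finset.sum_nonneg fun _ _ => Finset.sum_nonneg fun _ _ => by
    positivity

theorem inv_gap_le (ℓ : Fin L) (i : ι) (s : S i) (a b : A i) :
    |M.f i ℓ s a - M.f i ℓ s b|⁻¹ ≤ M.gapConst := by
  have h0 : ∀ (ℓ : Fin L) (j : GSA S A) (b : A j.1),
    0 ≤ |M.f j.1 ℓ j.2.1 j.2.2 - M.f j.1 ℓ j.2.1 b|⁻¹ := fun _ _ _ => by positivity
  calc |M.f i ℓ s a - M.f i ℓ s b|⁻¹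
      ≤ ∑ b, |M.f i ℓ s a - M.f i ℓ s b|⁻¹ :=
        Finset.single_le_sum (f := fun b => |M.f i ℓ s a - M.f i ℓ s b|⁻¹)
          (fun _ _ => h0 ℓ ⟨i, s, a⟩ _) (Finset.mem_univ b)
    _ ≤ ∑ j : GSA S A, ∑ b, |M.f j.1 ℓ j.2.1 j.2.2 - M.f j.1 ℓ j.2.1 b|⁻¹ :=
        Finset.single_le_sum
          (f := fun j : GSA S A => ∑ b, |M.f j.1 ℓ j.2.1 j.2.2 - M.f j.1 ℓ j.2.1 b|⁻¹)
          (fun j _ => Finset.sum_nonneg fun _ _ => h0 ℓ j _) (Finset.mem_univ ⟨i, s, a⟩)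
    _ ≤ M.gapConst :=
        Finset.single_le_sum
          (f := fun ℓ : Fin L =>
            ∑ j : GSA S A, ∑ b, |M.f j.1 ℓ j.2.1 j.2.2 - M.f j.1 ℓ j.2.1 b|⁻¹)
          (fun ℓ _ => Finset.sum_nonneg fun j _ => Finset.sum_nonneg fun _ _ => h0 ℓ j _)
          (Finset.mem_univ ℓ)

/-- `K'` arises from `K` by at most `n` reassignments, each of which was made at an excess of at
most `D`. -/
structure Moved (D : ℝ) (n : ℕ) (K K' : GSA S A → ℕ) : Prop where
  excess_le : ∀ ℓ, M.excess ℓ K' ≤ M.excess ℓ K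
  dist_le : ∀ j, |(K' j : ℝ) - K j| ≤ n * (M.gapConst * D + 1)
  sum_eq : ∀ i s, ∑ a, K' ⟨i, s, a⟩ = ∑ a, K ⟨i, s, a⟩

variable {M} {D : ℝ}

theorem Moved.mono (hD : 0 ≤ D) {n m : ℕ} {K K' : GSA S A → ℕ} (hK : M.Moved D n K K')
    (hnm : n ≤ m) : M.Moved D m K K' where
  excess_le := hK.excess_le
  dist_le j := (hK.dist_le j).trans <| mul_le_mul_of_nonneg_right (by exact_mod_cast hnm)
    (add_nonneg (mul_nonneg M.gapConst_nonneg hD) zero_le_one)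
  sum_eq := hK.sum_eq

theorem Moved.refl (D : ℝ) (K : GSA S A → ℕ) : M.Moved D 0 K K :=
  ⟨fun _ => le_rfl, by simp, fun _ _ => rfl⟩

theorem Moved.trans {n m : ℕ} {K K' K'' : GSA S A → ℕ} (hK : M.Moved D n K K')
    (hK' : M.Moved D m K' K'') : M.Moved D (n + m) K K'' where
  excess_le ℓ := (hK'.excess_le ℓ).trans (hK.excess_le ℓ)
  dist_le j := by
    have h1 := hK.dist_le j
    have h2 := hK'.dist_le j
    have h3 := abs_sub_le (K'' j : ℝ) (K' j) (K j)
    push_cast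
    linarith
  sum_eq i s := (hK'.sum_eq i s).trans (hK.sum_eq i s)

/-- Successive application of steps that move boundedly. -/
theorem moved_foldl {β : Type*} (F : (GSA S A → ℕ) → β → (GSA S A → ℕ)) (m : ℕ)
    (Q : (GSA S A → ℕ) → Prop) (hQ : ∀ K K', Q K → (∀ ℓ, M.excess ℓ K' ≤ M.excess ℓ K) → Q K')
    (hF : ∀ K b, Q K → M.Moved D m K (F K b)) (l : List β) (K : GSA S A → ℕ) (hK : Q K) :
    M.Moved D (l.length * m) K (l.foldl F K) := by
  induction l generalizing K with
  | nil => simpa using Moved.refl D K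
  | cons b l ih =>
    have h1 := hF K b hK
    have h2 := h1.trans (ih _ (hQ _ _ hK h1.excess_le))
    rw [List.length_cons, Nat.add_mul, one_mul, Nat.add_comm]
    exact h2

/-- At most the excess divided by a positive cost difference is moved, plus one for the ceiling.
Monotonicity is required for all constraints, so that repairing one never worsens another and the
bound `D` stays valid for later moves. -/
theorem moved_repairMove (hD : 0 ≤ D) (ℓ : Fin L) (i : ι) (s : S i) {a b : A i} (hab : a ≠ b)
    (hmono : ∀ ℓ', M.f i ℓ' s b ≤ M.f i ℓ' s a) {K : GSA S A → ℕ} (hK : M.excess ℓ K ≤ D) :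
    M.Moved D 1 K (M.repairMove ℓ i s a b K) := by
  unfold repairMove
  split_ifs with hex
  swap
  · exact (Moved.refl D K).mono hD zero_le_one
  set n := min (K ⟨i, s, a⟩) (M.needed ℓ i s a b K) with hn
  have hnK : n ≤ K ⟨i, s, a⟩ := min_le_left _ _
  have hG := M.gapConst_nonneg
  have hnD : (n : ℝ) ≤ M.gapConst * D + 1 := by
    have h1 : (n : ℝ) ≤ M.needed ℓ i s a b K := by exact_mod_cast min_le_right _ _
    refine h1.trans ?_
    unfold needed
    split_ifs with hgap
    · refine (Nat.ceil_lt_add_one (div_nonneg hex.le hgap.le)).le.trans ?_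
      have h2 := M.inv_gap_le ℓ i s a b
      rw [abs_of_pos hgap] at h2
      rw [div_eq_mul_inv, mul_comm]
      have h3 : (M.f i ℓ s a - M.f i ℓ s b)⁻¹ * M.excess ℓ K ≤ M.gapConst * D :=
        mul_le_mul h2 hK hex.le hG
      linarith
    · push_cast
      positivity
  constructor
  · intro ℓ'
    rw [M.excess_transfer ℓ' i s hab hnK]
    have := mul_nonneg (Nat.cast_nonneg (α := ℝ) n) (sub_nonneg.2 (hmono ℓ'))
    linarith
  · intro j
    rw [cast_transfer i s hab hnK, add_sub_cancel_left, Nat.cast_one, one_mul]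
    refine le_trans ?_ hnD
    have : (0 : ℝ) ≤ n := Nat.cast_nonneg n
    rw [abs_le]
    split_ifs <;> constructor <;> linarith
  · exact sum_transfer i s hab hnK

theorem moved_repairChain (hD : 0 ≤ D) (ℓ : Fin L) (i : ι) (s : S i) (l : List (A i))
    (hnodup : l.Nodup) (hmono : l.Pairwise fun b c => ∀ ℓ', M.f i ℓ' s c ≤ M.f i ℓ' s b)
    {K : GSA S A → ℕ} (hK : M.excess ℓ K ≤ D) :
    M.Moved D l.length K (M.repairChain ℓ i s l K) := by
  induction l generalizing K with
  | nil => exact Moved.refl D K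
  | cons a l ih =>
    cases l with
    | nil => exact (Moved.refl D K).mono hD (Nat.zero_le _)
    | cons b l =>
      rw [repairChain]
      have h1 := moved_repairMove hD ℓ i s (a := a) (b := b)
        (by rintro rfl; simp at hnodup) ((List.pairwise_cons.1 hmono).1 b (by simp)) hK
      have h2 := h1.trans (ih (List.nodup_cons.1 hnodup).2 (List.pairwise_cons.1 hmono).2
        ((h1.excess_le ℓ).trans hK))
      rw [List.length_cons, Nat.add_comm]
      exact h2

variable {cheap : ∀ i, S i → A i} {x : Fin (T + 1) → GSA S A → ℝ} (c : M.FABChoice cheap x)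

variable (A) in
/-- A bound for the number of actions of any gang. -/
def actionBound : ℕ := ∑ i, Fintype.card (A i)

theorem card_le_actionBound (i : ι) : Fintype.card (A i) ≤ actionBound A :=
  Finset.single_le_sum (f := fun i => Fintype.card (A i)) (fun _ _ => Nat.zero_le _)
    (Finset.mem_univ i)

theorem moved_repairStep (hD : 0 ≤ D) (ℓ : Fin L) {K : GSA S A → ℕ} (hK : M.excess ℓ K ≤ D)
    (j : GSA S A) :
    M.Moved D (actionBound A) K
      (if K j = 0 then K else M.repairChain ℓ j.1 j.2.1 (c.chain ℓ j.1 j.2.1 j.2.2) K) := by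
  split_ifs
  · exact (Moved.refl D K).mono hD (Nat.zero_le _)
  · exact (moved_repairChain hD ℓ j.1 j.2.1 _ (c.chain_nodup _ _ _ _) (c.chain_mono _ _ _ _)
      hK).mono hD ((c.chain_nodup _ _ _ _).length_le_card.trans (card_le_actionBound _))

theorem moved_repair (hD : 0 ≤ D) (t : Fin (T + 1)) (ℓ : Fin L) {K : GSA S A → ℕ}
    (hK : M.excess ℓ K ≤ D) :
    M.Moved D (Fintype.card (GSA S A) * actionBound A) K (M.repair c t ℓ K) := by
  refine (moved_foldl _ _ (fun K => M.excess ℓ K ≤ D) (fun _ _ h1 h2 => (h2 ℓ).trans h1)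
    (fun K j hK => moved_repairStep c hD ℓ hK j) (c.order t) K hK).mono hD ?_
  exact Nat.mul_le_mul_right _ (c.order_nodup t).length_le_card

theorem moved_fabCounts (hD : 0 ≤ D) (t : Fin (T + 1)) (σ : M.State h)
    (hK : ∀ ℓ, M.excess ℓ (M.lpApprox x (c.a₀ t) t σ) ≤ D) :
    M.Moved D (L * (Fintype.card (GSA S A) * actionBound A)) (M.lpApprox x (c.a₀ t) t σ)
      (M.fabCounts c t σ) := by
  have := moved_foldl (fun K ℓ => M.repair c t ℓ K) _ (fun K => ∀ ℓ, M.excess ℓ K ≤ D)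
    (fun _ _ h1 h2 ℓ => (h2 ℓ).trans (h1 ℓ)) (fun K ℓ hK => moved_repair c hD t ℓ (hK ℓ))
    (List.finRange L) _ hK
  rwa [List.length_finRange] at this

end Moves

/-! ### Rounding error and stability of the algorithm -/

section Rounding

variable (M : WCG ι S A L) {x : Fin (T + 1) → GSA S A → ℝ}

/-- This excludes truncation in the natural subtraction that defines the share of `a₀`. -/
theorem sum_floor_le (hx : ∀ t j, 0 ≤ x t j) (a₀ : ∀ i, S i → A i) (t : Fin (T + 1))
    (σ : M.State h) (i : ι) (s : S i) :
    ∑ a ∈ Finset.univ.erase (a₀ i s), ⌊alphaLP x t i s a * (M.stateCount σ i s : ℝ)⌋₊ ≤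
      M.stateCount σ i s := by
  have : Nonempty (A i) := ⟨a₀ i s⟩
  have h1 : (∑ a ∈ Finset.univ.erase (a₀ i s),
      (⌊alphaLP x t i s a * (M.stateCount σ i s : ℝ)⌋₊ : ℝ)) ≤ M.stateCount σ i s := by
    have h0 : ∀ a, 0 ≤ alphaLP x t i s a * (M.stateCount σ i s : ℝ) := fun a =>
      mul_nonneg (alphaLP_nonneg hx t i s a) (Nat.cast_nonneg _)
    calc _ ≤ ∑ a ∈ Finset.univ.erase (a₀ i s), alphaLP x t i s a * (M.stateCount σ i s : ℝ) :=
          Finset.sum_le_sum fun a _ => Nat.floor_le (h0 a)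
      _ ≤ ∑ a, alphaLP x t i s a * (M.stateCount σ i s : ℝ) :=
          Finset.sum_le_sum_of_subset_of_nonneg (Finset.erase_subset _ _) fun a _ _ => h0 a
      _ = M.stateCount σ i s := by rw [← Finset.sum_mul, sum_alphaLP, one_mul]
  exact_mod_cast h1

theorem sum_lpApprox (hx : ∀ t j, 0 ≤ x t j) (a₀ : ∀ i, S i → A i) (t : Fin (T + 1))
    (σ : M.State h) (i : ι) (s : S i) :
    ∑ a, M.lpApprox x a₀ t σ ⟨i, s, a⟩ = M.stateCount σ i s := by
  have h1 := M.sum_floor_le hx a₀ t σ i s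
  rw [← Finset.add_sum_erase _ _ (Finset.mem_univ (a₀ i s))]
  have h2 : ∑ a ∈ Finset.univ.erase (a₀ i s), M.lpApprox x a₀ t σ ⟨i, s, a⟩ =
      ∑ a ∈ Finset.univ.erase (a₀ i s), ⌊alphaLP x t i s a * (M.stateCount σ i s : ℝ)⌋₊ :=
    Finset.sum_congr rfl fun a ha => by simp [lpApprox, Finset.ne_of_mem_erase ha]
  rw [h2]
  simp only [lpApprox, if_true]
  omega

/-- Each floor errs by at most one, and `a₀` collects the errors of all the other actions. -/
theorem abs_lpApprox_sub_le (hx : ∀ t j, 0 ≤ x t j) (a₀ : ∀ i, S i → A i) (t : Fin (T + 1))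
    (σ : M.State h) (j : GSA S A) :
    |(M.lpApprox x a₀ t σ j : ℝ) - alphaLP x t j.1 j.2.1 j.2.2 * M.stateCount σ j.1 j.2.1| ≤
      actionBound A := by
  obtain ⟨i, s, a⟩ := j
  have : Nonempty (A i) := ⟨a⟩
  have hcard : (Fintype.card (A i) : ℝ) ≤ actionBound A := by
    exact_mod_cast card_le_actionBound i
  have hfl : ∀ a, |(⌊alphaLP x t i s a * (M.stateCount σ i s : ℝ)⌋₊ : ℝ) -
      alphaLP x t i s a * (M.stateCount σ i s : ℝ)| ≤ 1 := by
    intro a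
    have h1 := Nat.floor_le (mul_nonneg (alphaLP_nonneg hx t i s a)
      (Nat.cast_nonneg (α := ℝ) (M.stateCount σ i s)))
    have h2 := Nat.lt_floor_add_one (alphaLP x t i s a * (M.stateCount σ i s : ℝ))
    rw [abs_le]
    constructor <;> linarith
  have h1card : (1 : ℝ) ≤ Fintype.card (A i) := by
    exact_mod_cast Fintype.card_pos
  dsimp only
  by_cases ha : a = a₀ i s
  · have h1 := M.sum_floor_le hx a₀ t σ i s
    have h2 : alphaLP x t i s a * (M.stateCount σ i s : ℝ) = M.stateCount σ i s -
        ∑ a ∈ Finset.univ.erase (a₀ i s), alphaLP x t i s a * (M.stateCount σ i s : ℝ) := by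
      rw [← Finset.sum_mul, ha]
      have := Finset.add_sum_erase Finset.univ (alphaLP x t i s) (Finset.mem_univ (a₀ i s))
      rw [sum_alphaLP] at this
      linear_combination (M.stateCount σ i s : ℝ) * this
    rw [h2]
    simp only [lpApprox, ha, if_true]
    rw [Nat.cast_sub h1]
    push_cast
    rw [sub_sub_sub_cancel_left, ← Finset.sum_sub_distrib]
    refine (Finset.abs_sum_le_sum_abs _ _).trans ?_
    calc _ ≤ ∑ a ∈ Finset.univ.erase (a₀ i s), (1 : ℝ) :=
          Finset.sum_le_sum fun a _ => by rw [abs_sub_comm]; exact hfl a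
      _ ≤ ∑ a : A i, (1 : ℝ) :=
          Finset.sum_le_sum_of_subset_of_nonneg (Finset.erase_subset _ _) fun _ _ _ => zero_le_one
      _ = Fintype.card (A i) := by simp
      _ ≤ _ := hcard
  · simp only [lpApprox, ha, if_false]
    exact (hfl a).trans (h1card.trans hcard)

theorem alphaLP_le_one (hx : ∀ t j, 0 ≤ x t j) (t : Fin (T + 1)) (i : ι) (s : S i) (a : A i) :
    alphaLP x t i s a ≤ 1 := by
  have : Nonempty (A i) := ⟨a⟩
  rw [← sum_alphaLP (x := x) t i s]
  exact Finset.single_le_sum (fun a _ => alphaLP_nonneg hx t i s a) (Finset.mem_univ a)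

/-- The counts of the algorithm deviate from the fluid limit by at most a multiple of the deviation
of the state counts, up to a constant. -/
theorem exists_fabCounts_bound {cheap : ∀ i, S i → A i} {y₀ : ∀ i, S i → ℝ}
    (hx : M.LPFeasible y₀ x) (c : M.FABChoice cheap x) :
    ∃ B : ℝ, 0 ≤ B ∧ ∀ (h : ℕ) (t : Fin (T + 1)) (σ : M.State h) (Δ : ℝ), 0 ≤ Δ →
      (∀ i s, |(M.stateCount σ i s : ℝ) - h * M.N₀ i * ∑ a, x t ⟨i, s, a⟩| ≤ Δ) →
      ∀ j, |(M.fabCounts c t σ j : ℝ) - h * M.N₀ j.1 * x t j| ≤ B * (Δ + 1) := by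
  have hx0 : ∀ t j, 0 ≤ x t j := fun t j => (hx.mem_Icc t j).1
  set b : ℝ := (actionBound A : ℝ) with hb
  set F : ℝ := ∑ ℓ : Fin L, ∑ j : GSA S A, |M.f j.1 ℓ j.2.1 j.2.2| with hF
  set m : ℕ := L * (Fintype.card (GSA S A) * actionBound A) with hm
  have hb0 : 0 ≤ b := Nat.cast_nonneg _
  have hF0 : 0 ≤ F := by positivity
  have hG0 := M.gapConst_nonneg
  -- The first summand accounts for at most `m` moves at excess at most `F * (b + Δ)`, the second
  -- for rounding and state deviation `b + Δ`; in both, `b + Δ ≤ (b + 1) * (Δ + 1)`.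
  refine ⟨m * (M.gapConst * (F * (b + 1)) + 1) + (b + 1), by positivity, ?_⟩
  intro h t σ Δ hΔ hσ
  have hK0 : ∀ j, |(M.lpApprox x (c.a₀ t) t σ j : ℝ) - h * M.N₀ j.1 * x t j| ≤ b + Δ := by
    intro j
    have h1 := M.abs_lpApprox_sub_le hx0 (c.a₀ t) t σ j
    have h2 : |alphaLP x t j.1 j.2.1 j.2.2 * M.stateCount σ j.1 j.2.1 -
        h * M.N₀ j.1 * x t j| ≤ Δ := by
      have h3 : alphaLP x t j.1 j.2.1 j.2.2 * M.stateCount σ j.1 j.2.1 - h * M.N₀ j.1 * x t j =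
          alphaLP x t j.1 j.2.1 j.2.2 * ((M.stateCount σ j.1 j.2.1 : ℝ) -
            h * M.N₀ j.1 * ∑ a, x t ⟨j.1, j.2.1, a⟩) := by
        rw [show x t j = _ from (alphaLP_mul_sum hx0 t j.1 j.2.1 j.2.2).symm]
        ring
      rw [h3, abs_mul, abs_of_nonneg (alphaLP_nonneg hx0 _ _ _ _)]
      exact (mul_le_of_le_one_left (abs_nonneg _) (alphaLP_le_one hx0 _ _ _ _)).trans (hσ _ _)
    exact (abs_sub_le _ _ _).trans (add_le_add h1 h2)
  have hex : ∀ ℓ, M.excess ℓ (M.lpApprox x (c.a₀ t) t σ) ≤ F * (b + Δ) := by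
    intro ℓ
    -- The LP point contributes a nonpositive term to the excess, so only the deviation from it can
    -- cause a violation.
    have h1 : M.excess ℓ (M.lpApprox x (c.a₀ t) t σ) =
        ∑ j : GSA S A, ((M.lpApprox x (c.a₀ t) t σ j : ℝ) - h * M.N₀ j.1 * x t j) *
          M.f j.1 ℓ j.2.1 j.2.2 +
        h * ∑ j : GSA S A, (M.N₀ j.1 : ℝ) * x t j * M.f j.1 ℓ j.2.1 j.2.2 := by
      unfold excess
      rw [Finset.mul_sum, ← Finset.sum_add_distrib]
      exact Finset.sum_congr rfl fun j _ => by ring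
    have h2 := mul_nonpos_of_nonneg_of_nonpos (Nat.cast_nonneg (α := ℝ) h) (hx.coupling ℓ t)
    have h3 : ∑ j : GSA S A, ((M.lpApprox x (c.a₀ t) t σ j : ℝ) - h * M.N₀ j.1 * x t j) *
          M.f j.1 ℓ j.2.1 j.2.2 ≤ (∑ j : GSA S A, |M.f j.1 ℓ j.2.1 j.2.2|) * (b + Δ) := by
      rw [Finset.sum_mul]
      refine Finset.sum_le_sum fun j _ => (le_abs_self _).trans ?_
      rw [abs_mul, mul_comm]
      exact mul_le_mul_of_nonneg_left (hK0 j) (abs_nonneg _)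
    have h4 : ∑ j : GSA S A, |M.f j.1 ℓ j.2.1 j.2.2| ≤ F :=
      Finset.single_le_sum (f := fun ℓ : Fin L => ∑ j : GSA S A, |M.f j.1 ℓ j.2.1 j.2.2|)
        (fun _ _ => by positivity) (Finset.mem_univ ℓ)
    have h5 := mul_le_mul_of_nonneg_right h4 (add_nonneg hb0 hΔ)
    linarith
  intro j
  have h1 := (moved_fabCounts c (mul_nonneg hF0 (add_nonneg hb0 hΔ)) t σ hex).dist_le j
  refine (abs_sub_le _ _ _).trans ((add_le_add h1 (hK0 j)).trans ?_)
  have h2 : F * (b + Δ) ≤ F * (b + 1) * (Δ + 1) := by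
    rw [mul_assoc]
    exact mul_le_mul_of_nonneg_left (by nlinarith) hF0
  have h3 : M.gapConst * (F * (b + Δ)) + 1 ≤ (M.gapConst * (F * (b + 1)) + 1) * (Δ + 1) := by
    have := mul_le_mul_of_nonneg_left h2 hG0
    nlinarith
  have h4 := mul_le_mul_of_nonneg_left h3 (Nat.cast_nonneg (α := ℝ) m)
  nlinarith

end Rounding

/-! ### Feasibility when the sequences have no costly ties -/

section TieFree

variable {M : WCG ι S A L} {cheap : ∀ i, S i → A i} {x : Fin (T + 1) → GSA S A → ℝ}

/-- Moving `needed` processes would have ended the violation, so the minimum was attained at the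
full content of `a`. -/
theorem repairMove_eq_zero (ℓ : Fin L) (i : ι) (s : S i) {a b : A i} (hab : a ≠ b)
    {K : GSA S A → ℕ} (hgap : M.f i ℓ s b < M.f i ℓ s a)
    (hex : 0 < M.excess ℓ (M.repairMove ℓ i s a b K)) :
    M.repairMove ℓ i s a b K ⟨i, s, a⟩ = 0 := by
  unfold repairMove at hex ⊢
  split_ifs at hex ⊢ with h0
  · have hgap' := sub_pos.2 hgap
    rw [M.excess_transfer ℓ i s hab (min_le_left _ _)] at hex
    rcases le_total (K ⟨i, s, a⟩) (M.needed ℓ i s a b K) with hle | hle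
    · simp [transfer, min_eq_left hle]
    · exfalso
      rw [min_eq_right hle, needed, if_pos hgap'] at hex
      have h1 := Nat.le_ceil (M.excess ℓ K / (M.f i ℓ s a - M.f i ℓ s b))
      rw [div_le_iff₀ hgap'] at h1
      linarith
  · exact absurd hex h0

theorem repairMove_of_ne (ℓ : Fin L) (i : ι) (s : S i) {a b : A i} {K : GSA S A → ℕ}
    {j : GSA S A} (ha : j ≠ ⟨i, s, a⟩) (hb : j ≠ ⟨i, s, b⟩) :
    M.repairMove ℓ i s a b K j = K j := by
  unfold repairMove
  split_ifs <;> simp [transfer, ha, hb]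

theorem repairChain_of_notMem (ℓ : Fin L) (i : ι) (s : S i) (l : List (A i)) {K : GSA S A → ℕ}
    {j : GSA S A} (hj : ∀ b ∈ l, j ≠ ⟨i, s, b⟩) : M.repairChain ℓ i s l K j = K j := by
  induction l generalizing K with
  | nil => rfl
  | cons a l ih =>
    cases l with
    | nil => rfl
    | cons b l =>
      rw [repairChain, ih fun b' hb' => hj b' (List.mem_cons_of_mem _ hb'),
        repairMove_of_ne ℓ i s (hj a (by simp)) (hj b (by simp))]

/-- If the violation persists, the repair empties all actions of a sequence without ties that are
not of minimal cost. -/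
theorem repairChain_eq_zero (ℓ : Fin L) (i : ι) (s : S i) (l : List (A i)) (hnodup : l.Nodup)
    (hlast : ∀ a ∈ l.getLast?, a = cheap i s)
    (hmono : l.Pairwise fun b c => ∀ ℓ', M.f i ℓ' s c ≤ M.f i ℓ' s b)
    (htie : l.Pairwise fun b b' =>
      M.f i ℓ s (cheap i s) < M.f i ℓ s b → M.f i ℓ s b' < M.f i ℓ s b)
    {K : GSA S A → ℕ} (hex : 0 < M.excess ℓ (M.repairChain ℓ i s l K)) {a : A i} (ha : a ∈ l)
    (hcost : M.f i ℓ s (cheap i s) < M.f i ℓ s a) : M.repairChain ℓ i s l K ⟨i, s, a⟩ = 0 := by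
  induction l generalizing K with
  | nil => simp at ha
  | cons a' l ih =>
    cases l with
    | nil =>
      obtain rfl : a = a' := by simpa using ha
      have := hlast a (by simp)
      exact absurd hcost (by rw [this]; exact lt_irrefl _)
    | cons b l =>
      rw [repairChain] at hex ⊢
      have hne : a' ≠ b := by rintro rfl; simp at hnodup
      obtain ⟨hn1, hn2⟩ := List.nodup_cons.1 hnodup
      obtain ⟨hm1, hm2⟩ := List.pairwise_cons.1 hmono
      obtain ⟨ht1, ht2⟩ := List.pairwise_cons.1 htie
      rcases List.mem_cons.1 ha with rfl | ha
      -- The head is emptied by its own move and never refilled, because the actions of a sequence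
      -- are distinct.
      · rw [repairChain_of_notMem]
        · refine repairMove_eq_zero ℓ i s hne (ht1 b (by simp) hcost) (hex.trans_le ?_)
          -- The bound `D` is taken to be the absolute value of the current excess; only the
          -- monotonicity of the excess matters here.
          exact (moved_repairChain (abs_nonneg _) ℓ i s (b :: l) hn2 hm2
            (le_abs_self _)).excess_le ℓ
        · intro b' hb' he
          simp only [Sigma.mk.injEq, heq_eq_eq, Prod.mk.injEq, true_and] at he
          exact hn1 (he ▸ hb')
      · exact ih hn2 (by simpa using hlast) hm2 ht2 hex ha

variable (c : M.FABChoice cheap x)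

/-- A violation at the end was present at all earlier stages. Induction from the end of the list
covers refilling: if the last triple's sequence meets `j`, that sequence empties it again, and
otherwise the count of `j` is unchanged. -/
theorem repair_foldl_eq_zero (htie : c.TieFree) (ℓ : Fin L) (l : List (GSA S A))
    (K : GSA S A → ℕ)
    (hex : 0 < M.excess ℓ (l.foldl (fun K j =>
      if K j = 0 then K else M.repairChain ℓ j.1 j.2.1 (c.chain ℓ j.1 j.2.1 j.2.2) K) K))
    {j : GSA S A} (hj : j ∈ l)
    (hcost : M.f j.1 ℓ j.2.1 (cheap j.1 j.2.1) < M.f j.1 ℓ j.2.1 j.2.2) :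
    l.foldl (fun K j =>
      if K j = 0 then K else M.repairChain ℓ j.1 j.2.1 (c.chain ℓ j.1 j.2.1 j.2.2) K) K j = 0 := by
  induction l using List.reverseRecOn with
  | nil => simp at hj
  | append_singleton l k ih =>
    rw [List.foldl_append, List.foldl_cons, List.foldl_nil] at hex ⊢
    set K' := l.foldl (fun K j =>
      if K j = 0 then K else M.repairChain ℓ j.1 j.2.1 (c.chain ℓ j.1 j.2.1 j.2.2) K) K
    have hex' : 0 < M.excess ℓ K' := hex.trans_le
      ((moved_repairStep c (abs_nonneg _) ℓ (le_abs_self _) k).excess_le ℓ)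
    split_ifs at hex ⊢ with hk
    · rcases List.mem_append.1 hj with hj | hj
      · exact ih hex' hj
      · rw [List.mem_singleton.1 hj, hk]
    · by_cases hjk : ∃ b ∈ c.chain ℓ k.1 k.2.1 k.2.2, j = ⟨k.1, k.2.1, b⟩
      · obtain ⟨b, hb, rfl⟩ := hjk
        refine repairChain_eq_zero ℓ k.1 k.2.1 _ (c.chain_nodup _ _ _ _) ?_ (c.chain_mono _ _ _ _)
          (htie _ _ _ _) hex hb hcost
        intro a ha
        rw [c.chain_last] at ha
        simpa using ha.symm
      · push Not at hjk
        rw [repairChain_of_notMem ℓ _ _ _ hjk]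
        rcases List.mem_append.1 hj with hj | hj
        · exact ih hex' hj
        · rw [List.mem_singleton.1 hj] at hjk
          exact absurd rfl (hjk k.2.2 (List.mem_of_mem_head? (by rw [c.chain_head]; rfl)))

/-- Only the cost of the occupied actions matters, so actions tied with `cheap` at the minimum are
as good as `cheap` itself. -/
theorem excess_eq_sum_stateCount (ℓ : Fin L) (σ : M.State h) {K : GSA S A → ℕ}
    (hsum : ∀ i s, ∑ a, K ⟨i, s, a⟩ = M.stateCount σ i s)
    (hK : ∀ j : GSA S A, K j ≠ 0 → M.f j.1 ℓ j.2.1 j.2.2 = M.f j.1 ℓ j.2.1 (cheap j.1 j.2.1)) :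
    M.excess ℓ K = ∑ i, ∑ n, M.f i ℓ (σ i n) (cheap i (σ i n)) := by
  unfold excess
  rw [sum_gsa]
  refine Finset.sum_congr rfl fun i _ => ?_
  rw [← M.sum_gsaCount_mul σ (fun i n => cheap i (σ i n)) i fun s _ => M.f i ℓ s (cheap i s)]
  refine Finset.sum_congr rfl fun s _ => ?_
  rw [← Finset.sum_mul, sum_gsaCount, ← hsum, Nat.cast_sum, Finset.sum_mul]
  refine Finset.sum_congr rfl fun a _ => ?_
  by_cases h0 : K ⟨i, s, a⟩ = 0
  · simp [h0]
  · rw [hK _ h0]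

theorem excess_repair_nonpos (hcheap : M.CheapestFeasible cheap) (htie : c.TieFree) (hh : 0 < h)
    (t : Fin (T + 1)) (ℓ : Fin L) (σ : M.State h) {K : GSA S A → ℕ}
    (hsum : ∀ i s, ∑ a, K ⟨i, s, a⟩ = M.stateCount σ i s) :
    M.excess ℓ (M.repair c t ℓ K) ≤ 0 := by
  by_contra! hex
  have h1 := (moved_repair c (abs_nonneg _) t ℓ (le_abs_self (M.excess ℓ K))).sum_eq
  have h2 := excess_eq_sum_stateCount (cheap := cheap) ℓ σ (fun i s => (h1 i s).trans (hsum i s))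
    fun j hj => by
      by_contra hne
      exact hj (repair_foldl_eq_zero c htie ℓ _ _ hex (c.order_mem t j)
        (lt_of_le_of_ne (hcheap.le _ _ _ _) (Ne.symm hne)))
  rw [h2] at hex
  exact absurd (hcheap.constraints h hh σ ℓ) (not_le.2 hex)

/-- Each repair settles its own constraint and increases no excess, so the constraints already
settled remain so. -/
theorem excess_fabCounts_nonpos (hcheap : M.CheapestFeasible cheap) (htie : c.TieFree)
    (hx : ∀ t j, 0 ≤ x t j) (hh : 0 < h) (t : Fin (T + 1)) (ℓ : Fin L) (σ : M.State h) :
    M.excess ℓ (M.fabCounts c t σ) ≤ 0 := by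
  have key : ∀ l : List (Fin L),
      (∀ i s, ∑ a, l.foldl (fun K ℓ => M.repair c t ℓ K) (M.lpApprox x (c.a₀ t) t σ) ⟨i, s, a⟩ =
        M.stateCount σ i s) ∧
      ∀ ℓ ∈ l, M.excess ℓ
        (l.foldl (fun K ℓ => M.repair c t ℓ K) (M.lpApprox x (c.a₀ t) t σ)) ≤ 0 := by
    intro l
    induction l using List.reverseRecOn with
    | nil => exact ⟨M.sum_lpApprox hx _ t σ, by simp⟩
    | append_singleton l k ih =>
      rw [List.foldl_append, List.foldl_cons, List.foldl_nil]
      set K := l.foldl (fun K ℓ => M.repair c t ℓ K) (M.lpApprox x (c.a₀ t) t σ)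
      have hm := moved_repair c (abs_nonneg _) t k (le_abs_self (M.excess k K))
      refine ⟨fun i s => (hm.sum_eq i s).trans (ih.1 i s), fun ℓ hℓ => ?_⟩
      rcases List.mem_append.1 hℓ with hℓ | hℓ
      · exact (hm.excess_le ℓ).trans (ih.2 ℓ hℓ)
      · rw [List.mem_singleton.1 hℓ]
        exact excess_repair_nonpos c hcheap htie hh t k σ ih.1
  exact (key (List.finRange L)).2 ℓ (List.mem_finRange ℓ)

/-- Without ties, every policy that realises the counts of the algorithm is feasible. -/
theorem IsFAB.feasible (hcheap : M.CheapestFeasible cheap) (htie : c.TieFree)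
    (hx : ∀ t j, 0 ≤ x t j) (hh : 0 < h) {ψ : M.Policy T h} (hψ : M.IsFAB c ψ) (s₀ : M.State h) :
    M.Feasible s₀ ψ := by
  intro ω hω t ℓ
  rw [M.action_of_trajProb_ne_zero s₀ hω t, ← excess_gsaCount, funext (hψ t (ω t).1)]
  exact excess_fabCounts_nonpos c hcheap htie hx hh t ℓ _

end TieFree

/-! ### Concentration around the fluid limit -/

section Concentration

variable (M : WCG ι S A L)

theorem sum_trans_mul_tail (σ : M.State h) (α : M.Action h) (i : ι) (s : S i) {θ : ℝ}
    (hθ0 : 0 ≤ θ) (hθ1 : θ ≤ 1) (δ : ℝ) :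
    ∑ σ', M.trans σ α σ' * (if δ < |(M.stateCount σ' i s : ℝ) -
        ∑ s', ∑ a', (M.gsaCount σ α ⟨i, s', a'⟩ : ℝ) * M.p i s' a' s| then 1 else 0) ≤
      2 * Real.exp (θ ^ 2 * (h * M.total) - θ * δ) := by
  have key := prod_weight_abs_tail (fun i n s' => M.p i (σ i n) (α i n) s')
    (fun _ _ _ => M.p_nonneg _ _ _ _) (fun _ _ => M.p_sum _ _ _)
    (fun i' s' => if (⟨i', s'⟩ : Σ i, S i) = ⟨i, s⟩ then 1 else 0)
    (fun _ _ => by split_ifs <;> norm_num) (fun _ _ => by split_ifs <;> norm_num) hθ0 hθ1 δ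
  have h1 : ∑ i, ((h * M.N₀ i : ℕ) : ℝ) = h * M.total := by
    simp only [total, Nat.cast_mul, Nat.cast_sum, Finset.mul_sum]
  rw [h1] at key
  refine le_of_eq_of_le (Finset.sum_congr rfl fun σ' _ => ?_) key
  have h2 : ∑ i', ∑ n, ((if (⟨i', σ' i' n⟩ : Σ i, S i) = ⟨i, s⟩ then (1 : ℝ) else 0) -
      ∑ s', M.p i' (σ i' n) (α i' n) s' *
        if (⟨i', s'⟩ : Σ i, S i) = ⟨i, s⟩ then (1 : ℝ) else 0) =
      (M.stateCount σ' i s : ℝ) -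
        ∑ s', ∑ a', (M.gsaCount σ α ⟨i, s', a'⟩ : ℝ) * M.p i s' a' s := by
    rw [Finset.sum_eq_single i, M.sum_gsaCount_mul σ α i fun s' a' => M.p i s' a' s,
      stateCount_eq_sum, Finset.sum_sub_distrib]
    · simp
    · intro i' _ hi
      simp [hi]
    · simp
  rw [h2]
  rfl

theorem expSmall_stateCount_deviation (s₀ : ∀ h : ℕ, M.State h) (π : ∀ h, M.ActionLaw T h)
    (hπ : ∀ h, (π h).IsStochastic) (t : Fin T) (i : ι) (s : S i) {δ : ℝ} (hδ : 0 < δ) :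
    ExpSmall fun h => M.prob (s₀ h) (π h) {ω | δ * h < |(M.stateCount (ω t.succ).1 i s : ℝ) -
      ∑ s', ∑ a', (M.gsaCount (ω t.castSucc).1 (ω t.castSucc).2 ⟨i, s', a'⟩ : ℝ) *
        M.p i s' a' s|} := by
  have hN : (0 : ℝ) ≤ M.total := Nat.cast_nonneg _
  -- With `θ * total ≤ δ / 2`, the quadratic term of the Chernoff exponent consumes at most half of
  -- the linear one, leaving the rate `θ * δ / 2`.
  set θ : ℝ := min 1 (δ / (2 * (M.total + 1))) with hθ
  have hθ0 : 0 < θ := lt_min one_pos (by positivity)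
  have hθN : θ * M.total ≤ δ / 2 := by
    have h1 : θ ≤ δ / (2 * (M.total + 1)) := min_le_right _ _
    rw [le_div_iff₀ (by positivity)] at h1
    nlinarith
  refine (ExpSmall.two_mul_exp (κ := θ * δ / 2) (by positivity)).mono (H := 0) fun h _ => ?_
  rw [M.prob_setOf_eq_expect (s₀ h) (hπ h), M.expect_step (s₀ h) (hπ h) t fun q σ' =>
    if δ * h < |(M.stateCount σ' i s : ℝ) -
      ∑ s', ∑ a', (M.gsaCount q.1 q.2 ⟨i, s', a'⟩ : ℝ) * M.p i s' a' s| then 1 else 0]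
  rw [← M.expect_const (s₀ h) (hπ h) (2 * Real.exp (-(θ * δ / 2) * h))]
  refine M.expect_mono (s₀ h) (hπ h) fun ω => ?_
  refine (M.sum_trans_mul_tail _ _ i s hθ0.le (min_le_left _ _) (δ * h)).trans ?_
  refine mul_le_mul_of_nonneg_left (Real.exp_le_exp.2 ?_) zero_le_two
  have h2 := mul_le_mul_of_nonneg_left hθN (mul_nonneg hθ0.le (Nat.cast_nonneg (α := ℝ) h))
  linarith

variable {cheap : ∀ i, S i → A i} {y₀ : ∀ i, S i → ℝ} (s₀ : ∀ h : ℕ, M.State h)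
  (hs₀ : ∀ h : ℕ, 0 < h → M.Y (s₀ h) = y₀) {x : Fin (T + 1) → GSA S A → ℝ}
  (hx : M.LPFeasible y₀ x) (c : M.FABChoice cheap x) (ψ : ∀ h : ℕ, M.Policy T h)
  (hψ : ∀ h : ℕ, 0 < h → M.IsFAB c (ψ h))
include hs₀ hx hψ

/-- Concentration of the occupation numbers of the algorithm around the fluid limit. -/
theorem expSmall_gsaCount_deviation (t : Fin (T + 1)) {δ : ℝ} (hδ : 0 < δ) :
    ExpSmall fun h => M.prob (s₀ h) (ψ h).law
      {ω | ∃ j, δ * h < |(M.gsaCount (ω t).1 (ω t).2 j : ℝ) - h * M.N₀ j.1 * x t j|} := by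
  obtain ⟨B, hB, hfab⟩ := M.exists_fabCounts_bound hx c
  -- Stability in contrapositive form: a deviation of some triple forces a deviation of some state
  -- count at the same time.
  have hred : ∀ (t : Fin (T + 1)) {δ : ℝ}, 0 < δ → ∃ η : ℝ, 0 < η ∧ ∃ H : ℕ, ∀ h : ℕ, H < h →
      ∀ ω : M.Traj T h, M.trajProb (s₀ h) (ψ h).law ω ≠ 0 →
      (∃ j, δ * h < |(M.gsaCount (ω t).1 (ω t).2 j : ℝ) - h * M.N₀ j.1 * x t j|) →
      ∃ k : Σ i, S i, η * h <
        |(M.stateCount (ω t).1 k.1 k.2 : ℝ) - h * M.N₀ k.1 * ∑ a, x t ⟨k.1, k.2, a⟩| := by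
    intro t δ hδ
    obtain ⟨H, hH⟩ := exists_nat_gt (2 * B / δ)
    -- In `B * (η * h + 1)`, the first term is at most `δ * h / 2` by this choice of `η`, and the
    -- constant `B` is below `δ * h / 2` for `h > 2 * B / δ`.
    refine ⟨δ / (2 * (B + 1)), by positivity, H, fun h hh ω hω => ?_⟩
    contrapose!
    intro hk j
    rw [M.action_of_trajProb_ne_zero (s₀ h) hω t, hψ h (Nat.zero_lt_of_lt hh) t]
    refine (hfab h t (ω t).1 (δ / (2 * (B + 1)) * h) (by positivity)
      (fun i s => hk ⟨i, s⟩) j).trans ?_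
    have hHh : (H : ℝ) < h := by exact_mod_cast hh
    have h1 := hH.trans hHh
    rw [div_lt_iff₀ hδ] at h1
    have h2 : B * (δ / (2 * (B + 1))) ≤ δ / 2 := by
      rw [mul_div_assoc', div_le_div_iff₀ (by positivity) two_pos]
      nlinarith
    have h3 := mul_le_mul_of_nonneg_right h2 (Nat.cast_nonneg (α := ℝ) h)
    linarith
  induction t using Fin.induction generalizing δ with
  | zero =>
    obtain ⟨η, hη, H, hH⟩ := hred 0 hδ
    -- The initial state counts equal the fluid values exactly, so the event is null for large `h`.
    refine ExpSmall.zero.mono (H := H) fun h hh => ?_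
    have hh0 : 0 < h := Nat.zero_lt_of_lt hh
    refine (M.prob_mono_ae (s₀ h) (ψ h).isStochastic_law (E' := ∅) fun ω hω hE => ?_).trans
      (by simp [prob])
    obtain ⟨k, hk⟩ := hH h hh ω hω hE
    have h2 : (0 : ℝ) < M.N₀ k.1 := by exact_mod_cast M.N₀_pos _
    rw [M.initial_state_of_trajProb_ne_zero (s₀ h) _ hω,
      M.stateCount_eq_of_Y (s₀ h) hh0 (hs₀ h hh0), hx.init] at hk
    have h3 : (h : ℝ) * M.total * y₀ k.1 k.2 -
        h * M.N₀ k.1 * (M.total / M.N₀ k.1 * y₀ k.1 k.2) = 0 := by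
      field_simp
      ring
    rw [h3, abs_zero] at hk
    exact absurd hk (not_lt.2 (by positivity))
  | succ t ih =>
    obtain ⟨η, hη, H, hH⟩ := hred t.succ hδ
    set m : ℝ := (Fintype.card (GSA S A) : ℝ) with hm
    have hm0 : 0 ≤ m := Nat.cast_nonneg _
    -- The budget `η` is halved: one half for the triple deviations at the previous time, of which
    -- at most `m` are propagated with weights at most one, the other for the fluctuation around the
    -- conditional mean.
    have h1 := ih (δ := η / (2 * (m + 1))) (by positivity)
    have h2 := ExpSmall.sum (Finset.univ : Finset (Σ i, S i)) fun k =>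
      M.expSmall_stateCount_deviation s₀ (fun h => (ψ h).law) (fun h => (ψ h).isStochastic_law)
        t k.1 k.2 (δ := η / 2) (by positivity)
    refine (h1.add h2).mono (H := H) fun h hh => ?_
    have hπ := (ψ h).isStochastic_law
    refine le_trans ?_ (add_le_add le_rfl (M.prob_exists_le (s₀ h) hπ _ _))
    refine le_trans ?_ (M.prob_union_le (s₀ h) hπ _ _)
    refine M.prob_mono_ae (s₀ h) hπ fun ω hω hE => ?_
    obtain ⟨⟨i, s⟩, hk⟩ := hH h hh ω hω hE
    by_contra hcon
    simp only [Set.mem_union, Set.mem_ofPred_eq, Finset.mem_univ, true_and, not_or, not_exists,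
      not_lt] at hcon
    obtain ⟨hc1, hc2⟩ := hcon
    have hc2 := hc2 ⟨i, s⟩
    dsimp only at hk hc2
    have h3 : (h : ℝ) * M.N₀ i * ∑ a, x t.succ ⟨i, s, a⟩ =
        ∑ s', ∑ a', (h : ℝ) * M.N₀ i * x t.castSucc ⟨i, s', a'⟩ * M.p i s' a' s := by
      rw [← hx.flow, Finset.mul_sum]
      refine Finset.sum_congr rfl fun s' _ => ?_
      rw [Finset.mul_sum]
      exact Finset.sum_congr rfl fun a' _ => by ring
    have hp1 : ∀ s' a', M.p i s' a' s ≤ 1 := fun s' a' => by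
      rw [← M.p_sum i s' a']
      exact Finset.single_le_sum (fun s _ => M.p_nonneg i s' a' s) (Finset.mem_univ s)
    have h4 : |∑ s', ∑ a',
        (M.gsaCount (ω t.castSucc).1 (ω t.castSucc).2 ⟨i, s', a'⟩ : ℝ) * M.p i s' a' s -
        h * M.N₀ i * ∑ a, x t.succ ⟨i, s, a⟩| ≤ η / 2 * h := by
      have hδ' : 0 ≤ η / (2 * (m + 1)) * h := by positivity
      rw [h3, ← Finset.sum_sub_distrib]
      simp only [← Finset.sum_sub_distrib, ← sub_mul]
      calc _ ≤ ∑ s', ∑ a' : A i, η / (2 * (m + 1)) * h := by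
            refine (Finset.abs_sum_le_sum_abs _ _).trans (Finset.sum_le_sum fun s' _ => ?_)
            refine (Finset.abs_sum_le_sum_abs _ _).trans (Finset.sum_le_sum fun a' _ => ?_)
            rw [abs_mul, abs_of_nonneg (M.p_nonneg _ _ _ _)]
            exact (mul_le_of_le_one_right (abs_nonneg _) (hp1 _ _)).trans (hc1 ⟨i, s', a'⟩)
        _ ≤ ∑ i, ∑ s' : S i, ∑ a' : A i, η / (2 * (m + 1)) * h :=
            Finset.single_le_sum
              (f := fun i => ∑ s' : S i, ∑ a' : A i, η / (2 * (m + 1)) * (h : ℝ))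
              (fun i _ => Finset.sum_nonneg fun _ _ => Finset.sum_nonneg fun _ _ => hδ')
              (Finset.mem_univ i)
        _ = m * (η / (2 * (m + 1)) * h) := by
            rw [← sum_gsa (g := fun _ : GSA S A => η / (2 * (m + 1)) * (h : ℝ))]
            simp [hm]
        _ = m * (η / (2 * (m + 1))) * h := by ring
        _ ≤ η / 2 * h := by
            refine mul_le_mul_of_nonneg_right ?_ (Nat.cast_nonneg h)
            rw [mul_div_assoc', div_le_div_iff₀ (by positivity) two_pos]
            nlinarith
    have h5 := abs_sub_le (M.stateCount (ω t.succ).1 i s : ℝ)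
      (∑ s', ∑ a',
        (M.gsaCount (ω t.castSucc).1 (ω t.castSucc).2 ⟨i, s', a'⟩ : ℝ) * M.p i s' a' s)
      (h * M.N₀ i * ∑ a, x t.succ ⟨i, s, a⟩)
    linarith

theorem expSmall_exists_gsaCount_deviation {δ : ℝ} (hδ : 0 < δ) :
    ExpSmall fun h => M.prob (s₀ h) (ψ h).law
      {ω | ∃ t j, δ * h < |(M.gsaCount (ω t).1 (ω t).2 j : ℝ) - h * M.N₀ j.1 * x t j|} := by
  refine (ExpSmall.sum Finset.univ fun t =>
    M.expSmall_gsaCount_deviation s₀ hs₀ hx c ψ hψ t hδ).mono (H := 0) fun h _ => ?_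
  refine le_trans ?_ (M.prob_exists_le (s₀ h) (ψ h).isStochastic_law Finset.univ _)
  exact M.prob_mono (s₀ h) (ψ h).isStochastic_law fun ω ⟨t, hω⟩ => ⟨t, Finset.mem_univ t, hω⟩

end Concentration

/-! ### From counts to occupation measures and rewards -/

section Deviations

variable (M : WCG ι S A L) {x : Fin (T + 1) → GSA S A → ℝ}

theorem abs_Z_sub_le (hh : 0 < h) (σ : M.State h) (α : M.Action h) (t : Fin (T + 1)) (j : GSA S A)
    {δ : ℝ} (hδ : |(M.gsaCount σ α j : ℝ) - h * M.N₀ j.1 * x t j| ≤ δ * h) :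
    |M.Z (σ, α) j - M.N₀ j.1 * x t j / M.total| ≤ δ := by
  have h1 : (0 : ℝ) < h := by exact_mod_cast hh
  have h2 : (1 : ℝ) ≤ M.total := by exact_mod_cast M.total_pos j.1
  have h3 : M.Z (σ, α) j - M.N₀ j.1 * x t j / M.total =
      ((M.gsaCount σ α j : ℝ) - h * M.N₀ j.1 * x t j) / (h * M.total) := by
    unfold Z
    field_simp
  rw [h3, abs_div, abs_of_pos (by positivity : (0 : ℝ) < h * M.total), div_le_iff₀ (by positivity)]
  have h4 : 0 ≤ δ * h := (abs_nonneg _).trans hδ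
  nlinarith

theorem abs_pathReward_sub_le (hh : 0 < h) (ω : M.Traj T h) {δ : ℝ}
    (hδ : ∀ t j, |(M.gsaCount (ω t).1 (ω t).2 j : ℝ) - h * M.N₀ j.1 * x t j| ≤ δ * h) :
    |M.pathReward ω - M.lpValue x| ≤
      (∑ _t : Fin (T + 1), ∑ j : GSA S A, M.r j.1 j.2.1 j.2.2) * δ := by
  have h1 : (0 : ℝ) < h := by exact_mod_cast hh
  rw [pathReward_eq, lpValue, ← Finset.sum_sub_distrib, Finset.sum_mul]
  refine (Finset.abs_sum_le_sum_abs _ _).trans (Finset.sum_le_sum fun t _ => ?_)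
  rw [← Finset.sum_sub_distrib, Finset.sum_mul]
  refine (Finset.abs_sum_le_sum_abs _ _).trans (Finset.sum_le_sum fun j _ => ?_)
  have h3 : M.r j.1 j.2.1 j.2.2 * ((M.gsaCount (ω t).1 (ω t).2 j : ℝ) / h) -
      M.r j.1 j.2.1 j.2.2 * x t j * M.N₀ j.1 =
      M.r j.1 j.2.1 j.2.2 *
        (((M.gsaCount (ω t).1 (ω t).2 j : ℝ) - h * M.N₀ j.1 * x t j) / h) := by
    field_simp
  rw [h3, abs_mul, abs_of_nonneg (M.r_nonneg _ _ _), abs_div, abs_of_pos h1]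
  exact mul_le_mul_of_nonneg_left ((div_le_iff₀ h1).2 (hδ t j)) (M.r_nonneg _ _ _)

/-- The trivial bound, to be used on the exceptional event when tail estimates are turned into
estimates of means. -/
theorem abs_gsaCount_sub_le (hx : ∀ t j, x t j ∈ Set.Icc (0 : ℝ) 1) (σ : M.State h)
    (α : M.Action h) (t : Fin (T + 1)) (j : GSA S A) :
    |(M.gsaCount σ α j : ℝ) - h * M.N₀ j.1 * x t j| ≤ M.total * h := by
  have h1 : (M.gsaCount σ α j : ℝ) ≤ h * M.N₀ j.1 := by exact_mod_cast M.gsaCount_le σ α j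
  have h2 : (M.N₀ j.1 : ℝ) ≤ M.total := by
    exact_mod_cast Finset.single_le_sum (f := M.N₀) (fun _ _ => Nat.zero_le _)
      (Finset.mem_univ j.1)
  have h3 : (h : ℝ) * M.N₀ j.1 ≤ M.total * h := by
    rw [mul_comm]
    exact mul_le_mul_of_nonneg_right h2 (Nat.cast_nonneg h)
  have h4 : (0 : ℝ) ≤ h * M.N₀ j.1 := by positivity
  have h5 := mul_le_of_le_one_right h4 (hx t j).2
  have h6 := mul_nonneg h4 (hx t j).1
  have h7 : (0 : ℝ) ≤ M.gsaCount σ α j := Nat.cast_nonneg _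
  rw [abs_le]
  constructor <;> linarith

end Deviations

end

end WCG

/-! ### Assembly of the main theorem -/

theorem mainTheorem4 {ι : Type*} {S A : ι → Type*} {L T : ℕ}
    [Fintype ι] [DecidableEq ι]
    [∀ i, Fintype (S i)] [∀ i, DecidableEq (S i)]
    [∀ i, Fintype (A i)] [∀ i, DecidableEq (A i)]
    (M : WCG ι S A L)
    (cheap : ∀ i, S i → A i) (hcheap : M.CheapestFeasible cheap)
    (y₀ : ∀ i, S i → ℝ) (s₀ : ∀ h : ℕ, M.State h)
    (hs₀ : ∀ h : ℕ, 0 < h → M.Y (s₀ h) = y₀)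
    (x : Fin (T + 1) → GSA S A → ℝ) (hx : M.LPOptimal y₀ x)
    (c : M.FABChoice cheap x)
    (ψ : ∀ h : ℕ, M.Policy T h) (hψ : ∀ h : ℕ, 0 < h → M.IsFAB c (ψ h)) :
    (c.TieFree → ∀ h : ℕ, 0 < h → M.Feasible (s₀ h) (ψ h)) ∧
    ∀ ε : ℝ, 0 < ε → ∃ (C C₁ C₂ : ℝ) (H : ℕ), 0 < C ∧ 0 < C₁ ∧ 0 < C₂ ∧ ∀ h : ℕ, H < h →
      M.prob (s₀ h) (ψ h).law
          {ω | ∃ t, ε < ‖M.Z (ω t) - M.meanZ (s₀ h) (M.lpPolicy x h) t‖}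
        ≤ Real.exp (-C * h) ∧
      (∀ t, ‖M.meanZ (s₀ h) (ψ h).law t - M.meanZ (s₀ h) (M.lpPolicy x h) t‖
        ≤ C₁ * Real.exp (-C₂ * h) + ε) ∧
      M.prob (s₀ h) (ψ h).law {ω | ε < |M.pathReward ω - M.lpValue x|} ≤ Real.exp (-C * h) ∧
      |M.value (s₀ h) (ψ h).law - M.lpValue x| ≤ C₁ * Real.exp (-C₂ * h) + ε ∧
      ∀ φ : M.Policy T h, M.Feasible (s₀ h) φ →
        M.value (s₀ h) φ.law ≤ M.value (s₀ h) (ψ h).law + C₁ * Real.exp (-C₂ * h) + ε := by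
  -- Each gang has a process already at `h = 1`; its initial state yields an action. Without actions
  -- `alphaLP` would not be a probability vector.
  have hA : ∀ i, Nonempty (A i) := fun i =>
    ⟨c.a₀ 0 i (s₀ 1 i ⟨0, by have := M.N₀_pos i; omega⟩)⟩
  refine ⟨fun htie h hh => (hψ h hh).feasible c hcheap htie (fun t j => (hx.1.mem_Icc t j).1) hh _,
    fun ε hε => ?_⟩
  set R : ℝ := ∑ _t : Fin (T + 1), ∑ j : GSA S A, M.r j.1 j.2.1 j.2.2
  have hR : 0 ≤ R := Finset.sum_nonneg fun _ _ => Finset.sum_nonneg fun _ _ => M.r_nonneg _ _ _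
  -- One tolerance for both purposes: `δ ≤ ε` controls the occupation measures and `R * δ ≤ ε` the
  -- rewards.
  set δ : ℝ := ε / (R + 1) with hδdef
  have hδ : 0 < δ := by positivity
  have hδε : δ ≤ ε := div_le_self hε.le (by linarith)
  have hRδ : R * δ ≤ ε := by
    rw [hδdef, mul_div_assoc', div_le_iff₀ (by positivity)]
    nlinarith
  obtain ⟨C, hC, H, hprob⟩ := M.expSmall_exists_gsaCount_deviation s₀ hs₀ hx.1 c ψ hψ hδ
  have hN : (0 : ℝ) ≤ M.total := Nat.cast_nonneg _
  -- `R * total` and `total` bound the deviations of reward and occupation measure on the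
  -- exceptional event; the `1` ensures positivity.
  refine ⟨C, R * M.total + M.total + 1, C, H, hC, by positivity, hC, fun h hh => ?_⟩
  have hh0 : 0 < h := Nat.zero_lt_of_lt hh
  have hP := hprob h hh
  set E : Set (M.Traj T h) :=
    {ω | ∃ t j, δ * h < |(M.gsaCount (ω t).1 (ω t).2 j : ℝ) - h * M.N₀ j.1 * x t j|} with hE
  have hπ := (ψ h).isStochastic_law
  have hgood : ∀ ω, ω ∉ E → ∀ t j,
      |(M.gsaCount (ω t).1 (ω t).2 j : ℝ) - h * M.N₀ j.1 * x t j| ≤ δ * h := by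
    intro ω hω t j
    by_contra! hcon
    exact hω ⟨t, j, hcon⟩
  have hcrude : ∀ (ω : M.Traj T h) t j,
      |(M.gsaCount (ω t).1 (ω t).2 j : ℝ) - h * M.N₀ j.1 * x t j| ≤ M.total * h := fun ω t j =>
    M.abs_gsaCount_sub_le hx.1.mem_Icc _ _ t j
  have hz := M.meanZ_lpPolicy (s₀ h) hh0 (hs₀ h hh0) hx.1
  have hbound : ∀ B : ℝ, 0 ≤ B → B ≤ R * M.total + M.total + 1 →
      B * M.prob (s₀ h) (ψ h).law E + ε ≤
        (R * M.total + M.total + 1) * Real.exp (-C * h) + ε := fun B hB hB' =>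
    add_le_add (mul_le_mul hB' hP (M.prob_nonneg _ hπ _) (hB.trans hB')) le_rfl
  have hvalue : |M.value (s₀ h) (ψ h).law - M.lpValue x| ≤
      (R * M.total + M.total + 1) * Real.exp (-C * h) + ε := by
    rw [WCG.value, ← M.expect_const (s₀ h) hπ (M.lpValue x), ← WCG.expect_sub]
    refine (M.abs_expect_le (s₀ h) hπ (B := R * M.total) E hε.le
      (fun ω hω => (M.abs_pathReward_sub_le hh0 ω (hgood ω hω)).trans hRδ)
      (fun ω => M.abs_pathReward_sub_le hh0 ω (hcrude ω))).trans
      (hbound _ (by positivity) (by linarith))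
  refine ⟨?_, ?_, ?_, hvalue, ?_⟩
  · refine (M.prob_mono (s₀ h) hπ fun ω hω => ?_).trans hP
    by_contra hcon
    obtain ⟨t, ht⟩ := hω
    refine absurd ht (not_lt.2 ((pi_norm_le_iff_of_nonneg hε.le).2 fun j => ?_))
    rw [Pi.sub_apply, hz, Real.norm_eq_abs]
    exact (M.abs_Z_sub_le hh0 _ _ t j (hgood ω hcon t j)).trans hδε
  · intro t
    refine (pi_norm_le_iff_of_nonneg (by positivity)).2 fun j => ?_
    rw [Pi.sub_apply, hz, Real.norm_eq_abs, WCG.meanZ,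
      ← M.expect_const (s₀ h) hπ (M.N₀ j.1 * x t j / M.total), ← WCG.expect_sub]
    refine (M.abs_expect_le (s₀ h) hπ (B := M.total) E hε.le
      (fun ω hω => (M.abs_Z_sub_le hh0 _ _ t j (hgood ω hω t j)).trans hδε)
      (fun ω => M.abs_Z_sub_le hh0 _ _ t j (hcrude ω t j))).trans
      (hbound _ hN (by nlinarith))
  · refine (M.prob_mono (s₀ h) hπ fun ω hω => ?_).trans hP
    by_contra hcon
    exact absurd ((M.abs_pathReward_sub_le hh0 ω (hgood ω hcon)).trans hRδ) (not_le.2 hω)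
  · intro φ hφ
    -- Optimality of `x` enters only here; the approximation statements rest on its feasibility.
    have h1 := hφ.value_le M (s₀ h) hh0 (hs₀ h hh0) hx
    have h2 := (abs_le.1 hvalue).1
    linarith
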